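/- \textbf{Setting.} Let $(\Omega,\mu)$ be a $\sigma$-finite resonant measure space, i.e. $\int_0^\infty f^*(t)g^*(t)\,dt=\sup\int_\Omega|f\tilde g|\,d\mu$ for all measurable a.e. finite $f,g$, the supremum being over all $\tilde g$ equimeasurable with $g$. Here $m(f,s)=\mu\{|f|>s\}$, $f^*(t)=\inf\{s\ge 0: m(f,s)\le t\}$, and $f,g$ are equimeasurable if $m(f,\cdot)=m(g,\cdot)$. Let $G$ be an abelian (additively written) second countable locally compact Hausdorff group with Haar measure $dt$, acting on $\Omega$ by $\alpha$ such that $(\omega,t)\mapsto\alpha_t(\omega)$ is measurable, each $\alpha_t$ preserves $\mu$, and the induced action $t\mapsto(g\mapsto g\circ\alpha_t)$ on $L^\infty(\Omega)$ is point-weak* continuous: $t\mapsto\int_\Omega (g\circ\alpha_t) f\,d\mu$ is continuous for all $g\in L^\infty(\Omega)$, $f\in L^1(\Omega)$. Let $k_n\in L^1(G)$ ($n\in\mathbb N$) be (essentially) bounded, each vanishing a.e. outside a compact set, such that $\big(\int_G k_n(t)\,dt\big)_n$ converges and such that $(k_n*\phi)_n$ converges weakly in $L^1(G)$ for every $\phi\in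 L^1(G)$ with support of finite measure. Let $T_n(F)=k_n*F$. The transferred operator $T_n^\#$ is obtained by applying $T_n$ to the orbit function $t\mapsto f(\alpha_t\omega)$ and evaluating at $0$: $$T_n^\# f(\omega)=\int_G k_n(s)\,f(\alpha_{-s}\omega)\,ds ,\qquad T^\# f=\sup_n|T_n^\# f| .$$ A rearrangement invariant Banach function space (r.i. BFS) $X$ over $(\Omega,\mu)$ is the space of measurable $f$ with $\|f\|_X=\rho(|f|)<\infty$, where $\rho$ is a Banach function norm (definite, positively homogeneous, subadditive, monotone, with the Fatou property, finite on $\chi_A$ when $\mu(A)<\infty$, and with $\int_A f\,d\mu\le C_A\,\rho(f)$ when $\mu(A)<\infty$) that takes equal values on equimeasurable functions. Its fundamental function is $\varphi_X(\mu(A))=\|\chi_A\|_X$, extended to a quasi-concave function on $[0,\infty)$. A (sublinear) operator $T$ has weak type $(X,Y)$ if it maps $X$ into $M^*(\varphi_Y)$, the space of a.e. finite measurable $f$ with $\sup_{t>0}f^*(t)\varphi_Y(t)<\infty$. A Young's function is a convex nondecreasing $\Phi:[0,\infty]\to[0,\infty]$ with $\Phi(0)=0$, $\lim_{x\to\infty}\Phi(x)=\infty$,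 not infinite on all of $(0,\infty)$; it satisfies $\Delta_2$ (globally) if $\Phi(2x)\le K\Phi(x)$ for all $x\ge0$ and some constant $K>0$. The Orlicz space $L(\Phi)$ carries the Luxemburg norm $\inf\{c^{-1}:\int_\Omega\Phi(c|f|)\,d\mu\le1\}$; it is an r.i. BFS. \textbf{Corollary.} Let $X,Y,Z$ be r.i. BFSs over $(\Omega,\mu)$ (for instance $X$ an Orlicz space whose Young's function satisfies $\Delta_2$), and let $E=L(\Phi)$ be an Orlicz space over $(\Omega,\mu)$ with $\Phi$ satisfying $\Delta_2$. Suppose that $T^\#$ has weak type $(X,Y)$ and also weak type $(E,Z)$. If $X\cap E$ is dense in $X$, then for every $f\in X$ the sequence $(T_n^\# f(\omega))_n$ converges for $\mu$-almost every $\omega\in\Omega$. -/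

import Mathlib

open MeasureTheory Filter Topology
open scoped ENNReal NNReal Convolution

/-! ## Distribution functions, rearrangements, resonant measure spaces -/

section Rearrangement

variable {Ω : Type*} [MeasurableSpace Ω]

/-- The distribution function `m(u, s) = μ {ω | u ω > s}`; it is applied to absolute values. -/
noncomputable def distribFun (μ : Measure Ω) (u : Ω → ℝ≥0∞) (s : ℝ≥0∞) : ℝ≥0∞ :=
  μ {ω | s < u ω}

/-- The decreasing rearrangement `u*(t) = inf {s | m(u, s) ≤ t}`. -/
noncomputable def decRearr (μ : Measure Ω) (u : Ω → ℝ≥0∞) (t : ℝ≥0∞) : ℝ≥0∞ :=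
  sInf {s : ℝ≥0∞ | distribFun μ u s ≤ t}

/-- Two functions are equimeasurable if their distribution functions agree on `[0, ∞)`. -/
def Equimeasurable (μ : Measure Ω) (u v : Ω → ℝ≥0∞) : Prop :=
  ∀ s : ℝ≥0, distribFun μ u s = distribFun μ v s

/-- Resonant measure spaces: `∫₀^∞ f* g* dt = sup ∫ |f g'| dμ`, the supremum being taken over all
`g'` equimeasurable with `g`. Only the absolute values of the functions involved matter. -/
def IsResonant (μ : Measure Ω) : Prop :=
  ∀ f g : Ω → ℝ≥0, Measurable f → Measurable g →
    ∫⁻ t in Set.Ioi (0 : ℝ), decRearr μ (fun ω => (f ω : ℝ≥0∞)) (ENNReal.ofReal t) *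
        decRearr μ (fun ω => (g ω : ℝ≥0∞)) (ENNReal.ofReal t) =
      ⨆ (g' : Ω → ℝ≥0) (_ : Measurable g')
        (_ : Equimeasurable μ (fun ω => (g' ω : ℝ≥0∞)) (fun ω => (g ω : ℝ≥0∞))),
        ∫⁻ ω, (f ω : ℝ≥0∞) * (g' ω : ℝ≥0∞) ∂μ

end Rearrangement

/-! ## Rearrangement invariant Banach function spaces -/

/-- A rearrangement invariant Banach function norm on the `[0, ∞]`-valued `μ`-measurable
functions. -/
structure RIFunctionNorm {Ω : Type*} [MeasurableSpace Ω] (μ : Measure Ω) where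
  /-- the underlying functional -/
  toFun : (Ω → ℝ≥0∞) → ℝ≥0∞
  eq_zero_iff : ∀ u, AEMeasurable u μ → (toFun u = 0 ↔ u =ᵐ[μ] 0)
  map_mul : ∀ (a : ℝ≥0) (u), AEMeasurable u μ → toFun (fun ω => a * u ω) = a * toFun u
  map_add_le : ∀ u v, AEMeasurable u μ → AEMeasurable v μ →
    toFun (fun ω => u ω + v ω) ≤ toFun u + toFun v
  mono : ∀ u v, AEMeasurable u μ → AEMeasurable v μ → u ≤ᵐ[μ] v → toFun u ≤ toFun v
  fatou : ∀ (u : ℕ → Ω → ℝ≥0∞) (v : Ω → ℝ≥0∞), (∀ n, AEMeasurable (u n) μ) → AEMeasurable v μ →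
    (∀ᵐ ω ∂μ, Monotone (fun n => u n ω)) → (∀ᵐ ω ∂μ, ⨆ n, u n ω = v ω) →
    ⨆ n, toFun (u n) = toFun v
  indicator_lt_top : ∀ A : Set Ω, MeasurableSet A → μ A < ∞ →
    toFun (A.indicator (fun _ => 1)) < ∞
  setLIntegral_le : ∀ A : Set Ω, MeasurableSet A → μ A < ∞ →
    ∃ C : ℝ≥0, ∀ u, AEMeasurable u μ → ∫⁻ ω in A, u ω ∂μ ≤ C * toFun u
  rearr : ∀ u v, AEMeasurable u μ → AEMeasurable v μ → (∀ᵐ ω ∂μ, u ω < ∞) →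
    (∀ᵐ ω ∂μ, v ω < ∞) → Equimeasurable μ u v → toFun u = toFun v

namespace RIFunctionNorm

variable {Ω : Type*} [MeasurableSpace Ω] {μ : Measure Ω}

/-- The norm `‖f‖_X` of a complex-valued function. -/
noncomputable def norm (X : RIFunctionNorm μ) (f : Ω → ℂ) : ℝ≥0∞ := X.toFun (fun ω => ‖f ω‖ₑ)

/-- The functions that belong to the Banach function space given by the function norm `X`. -/
def space (X : RIFunctionNorm μ) : Set (Ω → ℂ) := {f | AEStronglyMeasurable f μ ∧ X.norm f < ∞}

/-- The fundamental function: `φ_X(t) = ‖χ_A‖_X` if `t = μ A`, extended to all of `[0, ∞)` as the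
least quasi-concave function above these values. -/
noncomputable def fundamental (X : RIFunctionNorm μ) (t : ℝ≥0) : ℝ≥0∞ :=
  ⨆ (A : Set Ω) (_ : MeasurableSet A) (_ : 0 < μ A) (_ : μ A < ∞),
    X.toFun (A.indicator (fun _ => 1)) * min 1 (t / μ A)

end RIFunctionNorm

/-- The quasi-norm `‖u‖_{M*(φ)} = sup_{t > 0} u*(t) φ(t)`. -/
noncomputable def mStarNorm {Ω : Type*} [MeasurableSpace Ω] (μ : Measure Ω) (φ : ℝ≥0 → ℝ≥0∞)
    (u : Ω → ℝ≥0∞) : ℝ≥0∞ :=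
  ⨆ (t : ℝ≥0) (_ : 0 < t), decRearr μ u t * φ t

/-- The (absolute values of) members of `M*(φ)`: the a.e. finite measurable functions with finite
quasi-norm. -/
def mStar {Ω : Type*} [MeasurableSpace Ω] (μ : Measure Ω) (φ : ℝ≥0 → ℝ≥0∞) :
    Set (Ω → ℝ≥0∞) :=
  {u | AEMeasurable u μ ∧ (∀ᵐ ω ∂μ, u ω < ∞) ∧ mStarNorm μ φ u < ∞}

/-- `T` (given through `|T f|`) has weak type `(X, Y)`: it maps `X` into `M*(φ_Y)`. -/
def HasWeakType {Ω : Type*} [MeasurableSpace Ω] {μ : Measure Ω}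
    (T : (Ω → ℂ) → (Ω → ℝ≥0∞)) (X Y : RIFunctionNorm μ) : Prop :=
  ∀ f ∈ X.space, T f ∈ mStar μ Y.fundamental

/-! ## Young's functions and Orlicz spaces -/

/-- Young's functions `Φ : [0, ∞] → [0, ∞]`. -/
structure IsYoungFunction (Φ : ℝ≥0∞ → ℝ≥0∞) : Prop where
  convex : ConvexOn ℝ≥0 Set.univ Φ
  mono : Monotone Φ
  map_zero : Φ 0 = 0
  tendsto_top : Tendsto (fun x : ℝ≥0 => Φ x) atTop (𝓝 ∞)
  exists_lt_top : ∃ x : ℝ≥0, 0 < x ∧ Φ x < ∞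

/-- The global `Δ₂` condition. -/
def SatisfiesDelta2 (Φ : ℝ≥0∞ → ℝ≥0∞) : Prop :=
  ∃ K : ℝ≥0, 0 < K ∧ ∀ x : ℝ≥0∞, Φ (2 * x) ≤ K * Φ x

/-- The Luxemburg functional `inf {c⁻¹ | ∫ Φ(c |f|) dμ ≤ 1}`. -/
noncomputable def luxemburg {Ω : Type*} [MeasurableSpace Ω] (μ : Measure Ω) (Φ : ℝ≥0∞ → ℝ≥0∞)
    (u : Ω → ℝ≥0∞) : ℝ≥0∞ :=
  ⨅ (c : ℝ≥0) (_ : 0 < c) (_ : ∫⁻ ω, Φ (c * u ω) ∂μ ≤ 1), (c : ℝ≥0∞)⁻¹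

section Luxemburg

variable {Ω : Type*} [MeasurableSpace Ω] {μ : Measure Ω} {Φ : ℝ≥0∞ → ℝ≥0∞}

theorem luxemburg_le {u : Ω → ℝ≥0∞} {c : ℝ≥0} (hc : 0 < c)
    (h : ∫⁻ ω, Φ (c * u ω) ∂μ ≤ 1) : luxemburg μ Φ u ≤ (c : ℝ≥0∞)⁻¹ :=
  iInf_le_of_le c (iInf_le_of_le hc (iInf_le_of_le h le_rfl))

theorem exists_of_luxemburg_lt {u : Ω → ℝ≥0∞} {a : ℝ≥0∞} (h : luxemburg μ Φ u < a) :
    ∃ c : ℝ≥0, 0 < c ∧ ∫⁻ ω, Φ (c * u ω) ∂μ ≤ 1 ∧ (c : ℝ≥0∞)⁻¹ < a := by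
  simp only [luxemburg, iInf_lt_iff] at h
  obtain ⟨c, hc, h1, h2⟩ := h
  exact ⟨c, hc, h1, h2⟩

theorem luxemburg_mono (hΦ : Monotone Φ) {u v : Ω → ℝ≥0∞} (h : u ≤ᵐ[μ] v) :
    luxemburg μ Φ u ≤ luxemburg μ Φ v := by
  refine le_of_forall_gt fun a ha => ?_
  obtain ⟨c, hc, h1, h2⟩ := exists_of_luxemburg_lt ha
  refine (luxemburg_le hc (le_trans (lintegral_mono_ae ?_) h1)).trans_lt h2
  filter_upwards [h] with ω hω
  exact hΦ (by gcongr)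

/-- It is enough to test all constants `c` below `a⁻¹`. -/
theorem luxemburg_le_of_forall {u : Ω → ℝ≥0∞} {a : ℝ≥0∞}
    (h : ∀ c : ℝ≥0, 0 < c → a < (c : ℝ≥0∞)⁻¹ → ∫⁻ ω, Φ (c * u ω) ∂μ ≤ 1) :
    luxemburg μ Φ u ≤ a := by
  refine le_of_forall_gt_imp_ge_of_dense fun b hb => ?_
  rcases eq_or_ne b ∞ with rfl | hb'
  · exact le_top
  have hb0 : b ≠ 0 := (pos_of_gt hb).ne'
  have hpos : 0 < (b⁻¹).toNNReal :=
    ENNReal.toNNReal_pos (ENNReal.inv_ne_zero.2 hb') (ENNReal.inv_ne_top.2 hb0)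
  have hcoe : (((b⁻¹).toNNReal : ℝ≥0) : ℝ≥0∞) = b⁻¹ :=
    ENNReal.coe_toNNReal (ENNReal.inv_ne_top.2 hb0)
  have := luxemburg_le (μ := μ) (Φ := Φ) (u := u) hpos
    (h _ hpos (by rw [hcoe, inv_inv]; exact hb))
  rwa [hcoe, inv_inv] at this

theorem luxemburg_mul_le (a : ℝ≥0) (ha : 0 < a) (u : Ω → ℝ≥0∞) :
    luxemburg μ Φ (fun ω => a * u ω) ≤ a * luxemburg μ Φ u := by
  have ha' : (a : ℝ≥0∞) ≠ 0 := by simpa using ha.ne'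
  rw [mul_comm, ← ENNReal.div_le_iff ha' ENNReal.coe_ne_top]
  refine le_of_forall_gt_imp_ge_of_dense fun b hb => ?_
  obtain ⟨c, hc, h1, h2⟩ := exists_of_luxemburg_lt hb
  have hca : 0 < c / a := div_pos hc ha
  have hmul : ((c / a : ℝ≥0) : ℝ≥0∞) * a = c := by
    rw [← ENNReal.coe_mul, div_mul_cancel₀ _ ha.ne']
  have := luxemburg_le (μ := μ) (Φ := Φ) (u := fun ω => a * u ω) hca
    (by simpa only [← mul_assoc, hmul] using h1)
  rw [ENNReal.div_le_iff ha' ENNReal.coe_ne_top]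
  refine this.trans ?_
  calc ((c / a : ℝ≥0) : ℝ≥0∞)⁻¹ = (c : ℝ≥0∞)⁻¹ * a := by
        rw [← ENNReal.coe_inv hca.ne', ← ENNReal.coe_inv hc.ne', ← ENNReal.coe_mul]
        congr 1; field_simp
    _ ≤ b * a := by gcongr

end Luxemburg

section Orlicz

variable {Ω : Type*} [MeasurableSpace Ω] {μ : Measure Ω} {Φ : ℝ≥0∞ → ℝ≥0∞}

theorem lintegral_le_of_distribFun_le {u v : Ω → ℝ≥0∞} (hu : AEMeasurable u μ)
    (hv : AEMeasurable v μ) (h : ∀ t : ℝ≥0, distribFun μ u t ≤ distribFun μ v t) :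
    ∫⁻ ω, u ω ∂μ ≤ ∫⁻ ω, v ω ∂μ := by
  have key : ∀ (n : ℕ) (w : Ω → ℝ≥0∞), AEMeasurable w μ →
      ∫⁻ ω, min (w ω) n ∂μ =
        ∫⁻ t in Set.Ioi (0 : ℝ), μ {ω | ENNReal.ofReal t < min (w ω) n} := by
    intro n w hw
    have hfin : ∀ ω, min (w ω) (n : ℝ≥0∞) ≠ ∞ := fun ω =>
      ((min_le_right _ _).trans_lt (ENNReal.natCast_lt_top n)).ne
    have h1 := lintegral_eq_lintegral_meas_lt μ (f := fun ω => (min (w ω) (n : ℝ≥0∞)).toReal)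
      (Eventually.of_forall fun ω => ENNReal.toReal_nonneg)
      (hw.min aemeasurable_const).ennreal_toReal
    simp only [ENNReal.ofReal_toReal (hfin _)] at h1
    rw [h1]
    refine setLIntegral_congr_fun measurableSet_Ioi fun t ht => ?_
    congr 1
    ext ω
    exact (ENNReal.ofReal_lt_iff_lt_toReal (le_of_lt ht) (hfin ω)).symm
  have hsup : ∀ (w : Ω → ℝ≥0∞), AEMeasurable w μ →
      ∫⁻ ω, w ω ∂μ = ⨆ n : ℕ, ∫⁻ ω, min (w ω) n ∂μ := by
    intro w hw
    rw [← lintegral_iSup' (fun n => hw.min aemeasurable_const)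
      (Eventually.of_forall fun ω m n hmn => min_le_min le_rfl (by exact_mod_cast hmn))]
    congr 1
    ext ω
    rw [← inf_iSup_eq, ENNReal.iSup_natCast, inf_top_eq]
  rw [hsup u hu, hsup v hv]
  refine iSup_mono fun n => ?_
  rw [key n u hu, key n v hv]
  refine lintegral_mono fun t => ?_
  by_cases hn : ENNReal.ofReal t < n
  · simp only [lt_min_iff, hn, and_true]
    exact h t.toNNReal
  · simp [hn]

namespace IsYoungFunction

theorem scale_le (hΦ : IsYoungFunction Φ) (a : ℝ≥0) (ha : a ≤ 1) (x : ℝ≥0∞) :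
    Φ (a * x) ≤ a * Φ x := by
  have := hΦ.convex.2 (Set.mem_univ x) (Set.mem_univ 0) (zero_le : 0 ≤ a) (zero_le : 0 ≤ 1 - a)
    (add_tsub_cancel_of_le ha)
  simpa [ENNReal.smul_def, hΦ.map_zero] using this

theorem map_top (hΦ : IsYoungFunction Φ) : Φ ∞ = ∞ :=
  top_unique (le_of_tendsto hΦ.tendsto_top (Eventually.of_forall fun _ => hΦ.mono le_top))

theorem measurable (hΦ : IsYoungFunction Φ) : Measurable Φ := hΦ.mono.measurable

theorem comp (hΦ : IsYoungFunction Φ) {u : Ω → ℝ≥0∞} (hu : AEMeasurable u μ) (c : ℝ≥0) :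
    AEMeasurable (fun ω => Φ (c * u ω)) μ :=
  hΦ.measurable.comp_aemeasurable (hu.const_mul _)

theorem luxemburg_eq_zero (hΦ : IsYoungFunction Φ) {u : Ω → ℝ≥0∞} (hu : AEMeasurable u μ) :
    luxemburg μ Φ u = 0 ↔ u =ᵐ[μ] 0 := by
  constructor
  · intro h
    have hn : ∀ n : ℕ, ∫⁻ ω, Φ ((n : ℝ≥0) * u ω) ∂μ ≤ 1 := by
      intro n
      have hlt : luxemburg μ Φ u < ((n : ℝ≥0) : ℝ≥0∞)⁻¹ := by
        rw [h]; exact ENNReal.inv_pos.2 ENNReal.coe_ne_top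
      obtain ⟨c, hc, h1, h2⟩ := exists_of_luxemburg_lt hlt
      have hnc : ((n : ℝ≥0) : ℝ≥0∞) ≤ c := (ENNReal.inv_lt_inv.1 h2).le
      exact le_trans (lintegral_mono fun ω => hΦ.mono (by gcongr)) h1
    have hint : ∫⁻ ω, ⨆ n : ℕ, Φ ((n : ℝ≥0) * u ω) ∂μ ≤ 1 := by
      rw [lintegral_iSup' (fun n => hΦ.comp hu n)
        (Eventually.of_forall fun ω m n hmn => hΦ.mono (by gcongr))]
      exact iSup_le hn
    have hae := ae_lt_top' (AEMeasurable.iSup fun n : ℕ => hΦ.comp hu (n : ℝ≥0))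
      (hint.trans_lt ENNReal.one_lt_top).ne
    filter_upwards [hae] with ω hω
    by_contra hne
    refine hω.ne (top_unique ?_)
    refine le_of_tendsto hΦ.tendsto_top (Eventually.of_forall fun x => ?_)
    obtain ⟨n, hn⟩ := ENNReal.exists_nat_mul_gt (a := u ω) (b := (x : ℝ≥0∞)) hne
      ENNReal.coe_ne_top
    exact le_iSup_of_le n (hΦ.mono (by simpa using hn.le))
  · intro h
    refine le_antisymm (luxemburg_le_of_forall fun c _ _ => ?_) zero_le
    have : ∫⁻ ω, Φ (c * u ω) ∂μ = 0 := by
      rw [lintegral_eq_zero_iff' (hΦ.comp hu c)]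
      filter_upwards [h] with ω hω
      simp [hω, hΦ.map_zero]
    rw [this]; exact zero_le

theorem luxemburg_map_mul (hΦ : IsYoungFunction Φ) (a : ℝ≥0) {u : Ω → ℝ≥0∞} :
    luxemburg μ Φ (fun ω => a * u ω) = a * luxemburg μ Φ u := by
  rcases eq_or_ne a 0 with rfl | ha
  · simpa using (hΦ.luxemburg_eq_zero (μ := μ) (u := fun _ => 0) aemeasurable_const).2 EventuallyEq.rfl
  have ha0 : 0 < a := pos_iff_ne_zero.2 ha
  refine le_antisymm (luxemburg_mul_le a ha0 u) ?_
  have h := luxemburg_mul_le (μ := μ) (Φ := Φ) a⁻¹ (inv_pos.2 ha0) (fun ω => a * u ω)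
  have h1 : (a : ℝ≥0∞) * (a⁻¹ : ℝ≥0) = 1 := by
    rw [← ENNReal.coe_mul, mul_inv_cancel₀ ha, ENNReal.coe_one]
  simp only [← mul_assoc, mul_comm ((a⁻¹ : ℝ≥0) : ℝ≥0∞) (a : ℝ≥0∞), h1, one_mul] at h
  calc (a : ℝ≥0∞) * luxemburg μ Φ u
      ≤ a * ((a⁻¹ : ℝ≥0) * luxemburg μ Φ (fun ω => a * u ω)) := by gcongr
    _ = luxemburg μ Φ (fun ω => a * u ω) := by rw [← mul_assoc, h1, one_mul]

theorem luxemburg_add_le (hΦ : IsYoungFunction Φ) {u v : Ω → ℝ≥0∞} (hu : AEMeasurable u μ) :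
    luxemburg μ Φ (fun ω => u ω + v ω) ≤ luxemburg μ Φ u + luxemburg μ Φ v := by
  refine le_of_forall_gt_imp_ge_of_dense fun b hb => ?_
  obtain ⟨b₁, h₁, b₂, h₂, hb₁₂⟩ : ∃ b₁, luxemburg μ Φ u < b₁ ∧ ∃ b₂, luxemburg μ Φ v < b₂ ∧
      b₁ + b₂ ≤ b := by
    rcases eq_or_ne b ∞ with rfl | hb'
    · have := ENNReal.add_lt_top.1 hb
      exact ⟨_, this.1, _, this.2, le_top⟩
    have hd : b - (luxemburg μ Φ u + luxemburg μ Φ v) ≠ 0 := (tsub_pos_of_lt hb).ne'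
    have hfin := ENNReal.add_lt_top.1 (lt_top_of_lt hb)
    refine ⟨_, ENNReal.lt_add_right hfin.1.ne (ENNReal.half_pos hd).ne', _,
      ENNReal.lt_add_right hfin.2.ne (ENNReal.half_pos hd).ne', ?_⟩
    rw [add_add_add_comm, ENNReal.add_halves, add_tsub_cancel_of_le hb.le]
  obtain ⟨c, hc, hc1, hc2⟩ := exists_of_luxemburg_lt h₁
  obtain ⟨d, hd, hd1, hd2⟩ := exists_of_luxemburg_lt h₂
  have he : 0 < c⁻¹ + d⁻¹ := add_pos (inv_pos.2 hc) (inv_pos.2 hd)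
  set e : ℝ≥0 := (c⁻¹ + d⁻¹)⁻¹ with hedef
  have hab : e * c⁻¹ + e * d⁻¹ = 1 := by
    rw [← mul_add, hedef, inv_mul_cancel₀ he.ne']
  have hc' : (e : ℝ≥0∞) = ((e * c⁻¹ : ℝ≥0) : ℝ≥0∞) * c := by
    rw [← ENNReal.coe_mul, mul_assoc, inv_mul_cancel₀ hc.ne', mul_one]
  have hd' : (e : ℝ≥0∞) = ((e * d⁻¹ : ℝ≥0) : ℝ≥0∞) * d := by
    rw [← ENNReal.coe_mul, mul_assoc, inv_mul_cancel₀ hd.ne', mul_one]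
  have hint : ∫⁻ ω, Φ (e * (u ω + v ω)) ∂μ ≤ 1 := by
    calc ∫⁻ ω, Φ (e * (u ω + v ω)) ∂μ
        ≤ ∫⁻ ω, ((e * c⁻¹ : ℝ≥0) : ℝ≥0∞) * Φ (c * u ω) +
            ((e * d⁻¹ : ℝ≥0) : ℝ≥0∞) * Φ (d * v ω) ∂μ := by
          refine lintegral_mono fun ω => ?_
          have := hΦ.convex.2 (Set.mem_univ (c * u ω)) (Set.mem_univ (d * v ω))
            (zero_le : 0 ≤ e * c⁻¹) (zero_le : 0 ≤ e * d⁻¹) hab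
          simp only [ENNReal.smul_def, smul_eq_mul] at this
          rwa [← mul_assoc, ← mul_assoc, ← hc', ← hd', ← mul_add] at this
      _ = ((e * c⁻¹ : ℝ≥0) : ℝ≥0∞) * ∫⁻ ω, Φ (c * u ω) ∂μ +
            ((e * d⁻¹ : ℝ≥0) : ℝ≥0∞) * ∫⁻ ω, Φ (d * v ω) ∂μ := by
          rw [lintegral_add_left' ((hΦ.comp hu c).const_mul _),
            lintegral_const_mul' _ _ ENNReal.coe_ne_top,
            lintegral_const_mul' _ _ ENNReal.coe_ne_top]
      _ ≤ ((e * c⁻¹ : ℝ≥0) : ℝ≥0∞) * 1 + ((e * d⁻¹ : ℝ≥0) : ℝ≥0∞) * 1 := by gcongr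
      _ = 1 := by rw [mul_one, mul_one, ← ENNReal.coe_add, hab, ENNReal.coe_one]
  refine (luxemburg_le (inv_pos.2 he) hint).trans (le_trans ?_ hb₁₂)
  rw [← ENNReal.coe_inv (inv_pos.2 he).ne', inv_inv, ENNReal.coe_add,
    ENNReal.coe_inv hc.ne', ENNReal.coe_inv hd.ne']
  exact add_le_add hc2.le hd2.le

theorem luxemburg_fatou (hΦ : IsYoungFunction Φ) (u : ℕ → Ω → ℝ≥0∞) (v : Ω → ℝ≥0∞)
    (hu : ∀ n, AEMeasurable (u n) μ) (hmono : ∀ᵐ ω ∂μ, Monotone (fun n => u n ω))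
    (hsup : ∀ᵐ ω ∂μ, ⨆ n, u n ω = v ω) : ⨆ n, luxemburg μ Φ (u n) = luxemburg μ Φ v := by
  refine le_antisymm (iSup_le fun n => luxemburg_mono hΦ.mono ?_) ?_
  · filter_upwards [hsup] with ω hω
    exact hω ▸ le_iSup (fun n => u n ω) n
  refine luxemburg_le_of_forall fun c hc hlt => ?_
  obtain ⟨b, hb1, hb2⟩ := exists_between hlt
  have hb0 : b ≠ 0 := (pos_of_gt hb1).ne'
  have hbt : b ≠ ∞ := (lt_top_of_lt hb2).ne
  have hd : (((b⁻¹).toNNReal : ℝ≥0) : ℝ≥0∞) = b⁻¹ :=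
    ENNReal.coe_toNNReal (ENNReal.inv_ne_top.2 hb0)
  set d : ℝ≥0 := (b⁻¹).toNNReal
  have hcd : (c : ℝ≥0∞) < d := by
    rw [hd]; simpa using ENNReal.inv_lt_inv.2 hb2
  have hn : ∀ n, ∫⁻ ω, Φ (d * u n ω) ∂μ ≤ 1 := by
    intro n
    obtain ⟨c', -, h1, h2⟩ := exists_of_luxemburg_lt
      ((le_iSup (fun n => luxemburg μ Φ (u n)) n).trans_lt hb1)
    refine le_trans (lintegral_mono fun ω => hΦ.mono ?_) h1
    have : (d : ℝ≥0∞) ≤ c' := by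
      rw [hd]; simpa using (ENNReal.inv_lt_inv.2 h2).le
    gcongr
  calc ∫⁻ ω, Φ (c * v ω) ∂μ ≤ ∫⁻ ω, ⨆ n, Φ (d * u n ω) ∂μ := by
        refine lintegral_mono_ae ?_
        filter_upwards [hsup] with ω hω
        rcases eq_or_ne (v ω) 0 with h0 | h0
        · rw [h0, mul_zero, hΦ.map_zero]; exact zero_le
        rcases eq_or_ne (v ω) ∞ with ht | ht
        · refine le_trans le_top ?_
          refine le_of_tendsto hΦ.tendsto_top (Eventually.of_forall fun x => ?_)
          have hlt : (x : ℝ≥0∞) / d < ⨆ n, u n ω := by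
            rw [hω, ht]
            exact ENNReal.div_lt_top ENNReal.coe_ne_top (pos_of_gt hcd).ne'
          obtain ⟨n, hn⟩ := lt_iSup_iff.1 hlt
          refine le_iSup_of_le n (hΦ.mono ?_)
          rw [mul_comm]
          exact ((ENNReal.div_lt_iff (Or.inl (pos_of_gt hcd).ne')
            (Or.inl ENNReal.coe_ne_top)).1 hn).le
        · have hlt : c * v ω < d * v ω := (ENNReal.mul_lt_mul_iff_left h0 ht).2 hcd
          have hd : (d : ℝ≥0∞) * v ω = ⨆ n, d * u n ω := by rw [← hω, ENNReal.mul_iSup]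
          rw [hd] at hlt
          obtain ⟨n, hn⟩ := lt_iSup_iff.1 hlt
          exact le_iSup_of_le n (hΦ.mono hn.le)
    _ = ⨆ n, ∫⁻ ω, Φ (d * u n ω) ∂μ := by
        refine lintegral_iSup' (fun n => hΦ.comp (hu n) d) ?_
        filter_upwards [hmono] with ω hω m n hmn
        exact hΦ.mono (by gcongr; exact hω hmn)
    _ ≤ 1 := iSup_le hn

theorem luxemburg_indicator_lt_top (hΦ : IsYoungFunction Φ) {A : Set Ω} (hA : MeasurableSet A)
    (hfin : μ A < ∞) : luxemburg μ Φ (A.indicator (fun _ => 1)) < ∞ := by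
  obtain ⟨x, hx, hxt⟩ := hΦ.exists_lt_top
  set r : ℝ≥0 := (Φ x * μ A).toNNReal
  have hr : (r : ℝ≥0∞) = Φ x * μ A := ENNReal.coe_toNNReal (ENNReal.mul_lt_top hxt hfin).ne
  have h1r : 0 < 1 + r := by positivity
  set a : ℝ≥0 := (1 + r)⁻¹
  have ha1 : a ≤ 1 := inv_le_one_of_one_le₀ (by simp)
  have hc : 0 < a * x := mul_pos (inv_pos.2 h1r) hx
  refine (luxemburg_le hc ?_).trans_lt (ENNReal.inv_lt_top.2 (by exact_mod_cast hc))
  calc ∫⁻ ω, Φ ((a * x : ℝ≥0) * A.indicator (fun _ => 1) ω) ∂μ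
      = ∫⁻ ω, A.indicator (fun _ => Φ ((a * x : ℝ≥0))) ω ∂μ := by
        congr 1; ext ω
        by_cases hω : ω ∈ A <;> simp [hω, hΦ.map_zero]
    _ = Φ ((a * x : ℝ≥0)) * μ A := lintegral_indicator_const hA _
    _ ≤ (a * Φ x) * μ A := by
        rw [ENNReal.coe_mul]; gcongr; exact hΦ.scale_le a ha1 x
    _ = ((a * r : ℝ≥0) : ℝ≥0∞) := by rw [mul_assoc, ← hr, ENNReal.coe_mul]
    _ ≤ 1 := by
        rw [← ENNReal.coe_one, ENNReal.coe_le_coe]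
        calc a * r ≤ a * (1 + r) := by gcongr; simp
          _ = 1 := inv_mul_cancel₀ h1r.ne'

theorem exists_le_add_mul (hΦ : IsYoungFunction Φ) :
    ∃ y : ℝ≥0, 0 < y ∧ ∀ x : ℝ≥0∞, x ≤ y + y * Φ x := by
  obtain ⟨y, hy0, hy⟩ : ∃ y : ℝ≥0, 0 < y ∧ 1 < Φ y :=
    ((eventually_gt_atTop 0).and
      (hΦ.tendsto_top.eventually (lt_mem_nhds ENNReal.one_lt_top))).exists
  refine ⟨y, hy0, fun x => ?_⟩
  rcases le_total x y with h | h
  · exact h.trans le_self_add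
  rcases eq_or_ne x ∞ with rfl | hx
  · rw [hΦ.map_top, ENNReal.mul_top (by exact_mod_cast hy0.ne')]; simp
  lift x to ℝ≥0 using hx
  have hyx : y ≤ x := by exact_mod_cast h
  have hx0 : x ≠ 0 := (hy0.trans_le hyx).ne'
  have h1 := hΦ.scale_le (y / x) (div_le_one_of_le₀ hyx zero_le) x
  rw [← ENNReal.coe_mul, div_mul_cancel₀ _ hx0] at h1
  refine le_trans ?_ le_add_self
  calc (x : ℝ≥0∞) = x * 1 := (mul_one _).symm
    _ ≤ x * ((y / x : ℝ≥0) * Φ x) := by gcongr; exact hy.le.trans h1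
    _ = y * Φ x := by
      rw [← mul_assoc, ← ENNReal.coe_mul, mul_div_cancel₀ _ hx0]

theorem exists_setLIntegral_le (hΦ : IsYoungFunction Φ) {A : Set Ω} (hfin : μ A < ∞) :
    ∃ C : ℝ≥0, ∀ u, AEMeasurable u μ → ∫⁻ ω in A, u ω ∂μ ≤ C * luxemburg μ Φ u := by
  obtain ⟨y, hy0, hy⟩ := hΦ.exists_le_add_mul
  have hm : ((μ A).toNNReal : ℝ≥0∞) = μ A := ENNReal.coe_toNNReal hfin.ne
  have hC : 0 < y * (μ A).toNNReal + y := by positivity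
  refine ⟨y * (μ A).toNNReal + y, fun u hu => ?_⟩
  have hC0 : ((y * (μ A).toNNReal + y : ℝ≥0) : ℝ≥0∞) ≠ 0 := by exact_mod_cast hC.ne'
  rw [mul_comm, ← ENNReal.div_le_iff hC0 ENNReal.coe_ne_top]
  refine le_of_forall_gt_imp_ge_of_dense fun b hb => ?_
  obtain ⟨c, hc, h1, h2⟩ := exists_of_luxemburg_lt hb
  rw [ENNReal.div_le_iff hC0 ENNReal.coe_ne_top]
  have hc0 : (c : ℝ≥0∞) ≠ 0 := by exact_mod_cast hc.ne'
  have h3 : c * ∫⁻ ω in A, u ω ∂μ ≤ ((y * (μ A).toNNReal + y : ℝ≥0) : ℝ≥0∞) := by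
    calc c * ∫⁻ ω in A, u ω ∂μ = ∫⁻ ω in A, c * u ω ∂μ :=
          (lintegral_const_mul' _ _ ENNReal.coe_ne_top).symm
      _ ≤ ∫⁻ ω in A, (y : ℝ≥0∞) + y * Φ (c * u ω) ∂μ := lintegral_mono fun ω => hy _
      _ = y * μ A + y * ∫⁻ ω in A, Φ (c * u ω) ∂μ := by
          rw [lintegral_add_left measurable_const, setLIntegral_const,
            lintegral_const_mul' _ _ ENNReal.coe_ne_top]
      _ ≤ y * μ A + y * 1 := by
          gcongr
          exact (setLIntegral_le_lintegral A _).trans h1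
      _ = _ := by rw [ENNReal.coe_add, ENNReal.coe_mul, hm, mul_one]
  calc ∫⁻ ω in A, u ω ∂μ = (c : ℝ≥0∞)⁻¹ * (c * ∫⁻ ω in A, u ω ∂μ) := by
        rw [← mul_assoc, ENNReal.inv_mul_cancel hc0 ENNReal.coe_ne_top, one_mul]
    _ ≤ b * ((y * (μ A).toNNReal + y : ℝ≥0) : ℝ≥0∞) := by gcongr

theorem luxemburg_rearr_le (hΦ : IsYoungFunction Φ) {u v : Ω → ℝ≥0∞} (hu : AEMeasurable u μ)
    (hv : AEMeasurable v μ) (h : Equimeasurable μ u v) : luxemburg μ Φ v ≤ luxemburg μ Φ u := by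
  refine luxemburg_le_of_forall fun c hc hlt => ?_
  obtain ⟨d, hd, h1, h2⟩ := exists_of_luxemburg_lt hlt
  have hcd : c < d := by exact_mod_cast ENNReal.inv_lt_inv.1 h2
  refine le_trans (lintegral_le_of_distribFun_le (hΦ.comp hv c) (hΦ.comp hu d) fun t => ?_) h1
  -- the least value at which `Φ (c * x) > t` can occur
  set s : ℝ≥0∞ := sInf {x | (t : ℝ≥0∞) < Φ (c * x)} with hs
  have hst : s ≠ ∞ := by
    obtain ⟨x, hx⟩ := (hΦ.tendsto_top.eventually
      (lt_mem_nhds (ENNReal.coe_lt_top (r := t)))).exists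
    have : s ≤ ((x / c : ℝ≥0) : ℝ≥0∞) := by
      refine sInf_le ?_
      change (t : ℝ≥0∞) < Φ (c * ((x / c : ℝ≥0) : ℝ≥0∞))
      rwa [← ENNReal.coe_mul, mul_div_cancel₀ _ hc.ne']
    exact (this.trans_lt ENNReal.coe_lt_top).ne
  rcases eq_or_ne s 0 with hs0 | hs0
  · have hpos : ∀ x : ℝ≥0∞, 0 < x → (t : ℝ≥0∞) < Φ (d * x) := by
      intro x hx
      have : sInf {x | (t : ℝ≥0∞) < Φ (c * x)} < x := by rwa [← hs, hs0]
      obtain ⟨y, hy, hyx⟩ := sInf_lt_iff.1 this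
      exact lt_of_lt_of_le hy (hΦ.mono (mul_le_mul' (by exact_mod_cast hcd.le) hyx.le))
    calc distribFun μ (fun ω => Φ (c * v ω)) t ≤ distribFun μ v (0 : ℝ≥0) := by
          refine measure_mono fun ω hω => ?_
          change ((0 : ℝ≥0) : ℝ≥0∞) < v ω
          rw [ENNReal.coe_zero, pos_iff_ne_zero]
          intro h0
          have : (t : ℝ≥0∞) < Φ (c * v ω) := hω
          rw [h0, mul_zero, hΦ.map_zero] at this
          exact absurd this not_lt_zero
      _ = distribFun μ u (0 : ℝ≥0) := (h 0).symm
      _ ≤ distribFun μ (fun ω => Φ (d * u ω)) t :=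
          measure_mono fun ω hω => hpos _ (by simpa using hω)
  · have hmul : c / d < 1 := (div_lt_one hd).2 hcd
    have hlt' : ((c / d : ℝ≥0) : ℝ≥0∞) * s < s := by
      conv_rhs => rw [← one_mul s]
      exact (ENNReal.mul_lt_mul_iff_left hs0 hst).2 (by exact_mod_cast hmul)
    obtain ⟨r, hr1, hr2⟩ := ENNReal.lt_iff_exists_nnreal_btwn.1 hlt'
    calc distribFun μ (fun ω => Φ (c * v ω)) t ≤ distribFun μ v r := by
          refine measure_mono fun ω hω => ?_
          exact hr2.trans_le (sInf_le hω)
      _ = distribFun μ u r := (h r).symm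
      _ ≤ distribFun μ (fun ω => Φ (d * u ω)) t := by
          refine measure_mono fun ω hω => ?_
          have hω' : (r : ℝ≥0∞) < u ω := hω
          have hsr : s < ((d / c : ℝ≥0) : ℝ≥0∞) * r := by
            have h3 : s = ((d / c : ℝ≥0) : ℝ≥0∞) * (((c / d : ℝ≥0) : ℝ≥0∞) * s) := by
              rw [← mul_assoc, ← ENNReal.coe_mul, div_mul_div_cancel₀ hc.ne',
                div_self hd.ne', ENNReal.coe_one, one_mul]
            rw [h3]
            exact (ENNReal.mul_lt_mul_iff_right (by simpa using (div_pos hd hc).ne')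
              ENNReal.coe_ne_top).2 hr1
          obtain ⟨y, hy, hyr⟩ := sInf_lt_iff.1 hsr
          refine lt_of_lt_of_le hy (hΦ.mono ?_)
          calc (c : ℝ≥0∞) * y ≤ c * (((d / c : ℝ≥0) : ℝ≥0∞) * r) := by gcongr
            _ = d * r := by
              rw [← mul_assoc, ← ENNReal.coe_mul, mul_div_cancel₀ _ hc.ne']
            _ ≤ d * u ω := by gcongr

end IsYoungFunction

/-- The Orlicz space `L(Φ)` over `(Ω, μ)`, with its Luxemburg norm, as a rearrangement invariant
Banach function space. -/
noncomputable def orlicz (μ : Measure Ω) (Φ : ℝ≥0∞ → ℝ≥0∞) (hΦ : IsYoungFunction Φ) :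
    RIFunctionNorm μ where
  toFun := luxemburg μ Φ
  eq_zero_iff _ hu := hΦ.luxemburg_eq_zero hu
  map_mul a _ _ := hΦ.luxemburg_map_mul a
  map_add_le _ _ hu _ := hΦ.luxemburg_add_le hu
  mono _ _ _ _ h := luxemburg_mono hΦ.mono h
  fatou u v hu _ hmono hsup := hΦ.luxemburg_fatou u v hu hmono hsup
  indicator_lt_top _ hA hfin := hΦ.luxemburg_indicator_lt_top hA hfin
  setLIntegral_le _ _ hfin := hΦ.exists_setLIntegral_le hfin
  rearr _ _ hu hv _ _ h := le_antisymm
    (hΦ.luxemburg_rearr_le hv hu fun s => (h s).symm) (hΦ.luxemburg_rearr_le hu hv h)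

end Orlicz

/-! ## Dynamical systems and transferred operators

The action of the additive group `G` on `Ω` is written `α_t(ω) = t +ᵥ ω`. -/

section Transfer

variable {Ω G : Type*} [MeasurableSpace Ω] [AddCommGroup G] [MeasurableSpace G]

/-- Convolution by `k`: `(k * F)(t) = ∫ k(s) F(t - s) ds`. -/
noncomputable def convOp (h : Measure G) (k : G → ℂ) : (G → ℂ) → (G → ℂ) :=
  fun F => k ⋆[ContinuousLinearMap.mul ℂ ℂ, h] F

/-- The transfer of an operator `T` on functions on `G` to functions on `Ω`: apply `T` to the
orbit function `t ↦ f(α_t ω)` and evaluate the result at the identity of `G`. -/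
def transfer [AddAction G Ω] (T : (G → ℂ) → (G → ℂ)) (f : Ω → ℂ) : Ω → ℂ :=
  fun ω => T (fun t => f (t +ᵥ ω)) 0

/-- The maximal operator `f ↦ sup_n |S_n f|`. -/
noncomputable def maximalOp (S : ℕ → (Ω → ℂ) → (Ω → ℂ)) (f : Ω → ℂ) : Ω → ℝ≥0∞ :=
  fun ω => ⨆ n, ‖S n f ω‖ₑ

/-- Point-weak* continuity of the action `t ↦ (g ↦ g ∘ α_t)` of `G` on `L^∞(Ω)`. -/
def IsPointWeakStarContinuous (G : Type*) [AddCommGroup G] [TopologicalSpace G] [AddAction G Ω]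
    (μ : Measure Ω) : Prop :=
  ∀ g : Ω → ℂ, MemLp g ∞ μ → ∀ f : Ω → ℂ, Integrable f μ →
    Continuous fun t : G => ∫ ω, g (t +ᵥ ω) * f ω ∂μ

/-- Weak convergence of a sequence in `L¹`. -/
def ConvergesWeaklyL1 (h : Measure G) (F : ℕ → G → ℂ) : Prop :=
  ∃ u : G → ℂ, Integrable u h ∧ ∀ g : G → ℂ, MemLp g ∞ h →
    Tendsto (fun n => ∫ t, F n t * g t ∂h) atTop (𝓝 (∫ t, u t * g t ∂h))

end Transfer

/-! The heart is a Banach principle, `IsLocallyBoundedSeq.ae_exists_tendsto`. Take operators that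
are linear up to null sets and bounded from a function space into `L¹` of every set of finite
measure. If the maximal function of every element is finite a.e., then the elements along which the
sequence converges a.e. form a closed set. Weak type enters only through this finiteness. Baire's
theorem, hence completeness of the space, turns it into a bound in measure that is uniform on a ball
(`exists_measure_maximalOp_le`).

What remains is convergence on a dense set. Transference turns convolution into composition
(`transfer_transfer`): for bounded `g`, applying `T_n^#` to `φ^# g` pairs `k_n * φ` with the bounded
orbit function `t ↦ g(α_{-t} ω)`, so weak `L¹` convergence gives a limit at every `ω`. Let `g = χ_A`
and let `φ` be the normalised indicator of a small neighbourhood of `0`. Weak* continuity makes `φ^#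
χ_A` close to `χ_A` in `L¹`; as the difference is bounded by `1`, `Δ₂` makes it small in `L(Φ)` too.

The Banach principle in `E` then gives convergence for `χ_A`, linearity gives simple functions, and
a second use gives all of `E`, since `Δ₂` makes simple functions dense. A third use, in `X`,
exploits the density of `X ∩ E`. -/

/-! ### Function norms: vector space structure and completeness. -/

namespace RIFunctionNorm

variable {Ω : Type*} [MeasurableSpace Ω] {μ : Measure Ω} (X : RIFunctionNorm μ)

theorem toFun_zero : X.toFun (fun _ => 0) = 0 :=
  (X.eq_zero_iff _ aemeasurable_const).2 EventuallyEq.rfl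

theorem norm_zero : X.norm 0 = 0 := by
  simpa [norm] using X.toFun_zero

theorem norm_add_le {f g : Ω → ℂ} (hf : AEStronglyMeasurable f μ)
    (hg : AEStronglyMeasurable g μ) : X.norm (f + g) ≤ X.norm f + X.norm g :=
  (X.mono _ _ (hf.add hg).enorm (hf.enorm.add hg.enorm)
    (Eventually.of_forall fun _ => enorm_add_le _ _)).trans
    (X.map_add_le _ _ hf.enorm hg.enorm)

theorem norm_sub_comm (f g : Ω → ℂ) : X.norm (f - g) = X.norm (g - f) := by
  simp only [norm, Pi.sub_apply]
  congr 1
  ext ω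
  rw [← enorm_neg, neg_sub]

theorem norm_smul (c : ℂ) {f : Ω → ℂ} (hf : AEStronglyMeasurable f μ) :
    X.norm (c • f) = ‖c‖ₑ * X.norm f := by
  rw [norm, norm, enorm_eq_nnnorm, ← X.map_mul _ _ hf.enorm]
  simp [enorm_eq_nnnorm]

variable {X}

theorem zero_mem_space : (0 : Ω → ℂ) ∈ X.space :=
  ⟨aestronglyMeasurable_zero, by simp [norm_zero]⟩

theorem add_mem_space {f g : Ω → ℂ} (hf : f ∈ X.space) (hg : g ∈ X.space) : f + g ∈ X.space :=
  ⟨hf.1.add hg.1, (X.norm_add_le hf.1 hg.1).trans_lt (ENNReal.add_lt_top.2 ⟨hf.2, hg.2⟩)⟩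

theorem smul_mem_space (c : ℂ) {f : Ω → ℂ} (hf : f ∈ X.space) : c • f ∈ X.space :=
  ⟨hf.1.const_smul c, by
    rw [X.norm_smul c hf.1]; exact ENNReal.mul_lt_top enorm_lt_top hf.2⟩

theorem sub_mem_space {f g : Ω → ℂ} (hf : f ∈ X.space) (hg : g ∈ X.space) : f - g ∈ X.space := by
  simpa [sub_eq_add_neg] using add_mem_space hf (smul_mem_space (-1) hg)

variable (X)

theorem norm_sub_le_add {f g k : Ω → ℂ} (hf : f ∈ X.space) (hg : g ∈ X.space)
    (hk : k ∈ X.space) : X.norm (f - k) ≤ X.norm (f - g) + X.norm (g - k) := by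
  have := X.norm_add_le (sub_mem_space hf hg).1 (sub_mem_space hg hk).1
  rwa [sub_add_sub_cancel] at this

/-- Countable subadditivity. -/
theorem toFun_tsum_le (u : ℕ → Ω → ℝ≥0∞) (hu : ∀ n, AEMeasurable (u n) μ) :
    X.toFun (fun ω => ∑' n, u n ω) ≤ ∑' n, X.toFun (u n) := by
  have hfin : ∀ N : ℕ, X.toFun (fun ω => ∑ n ∈ Finset.range N, u n ω) ≤
      ∑ n ∈ Finset.range N, X.toFun (u n) := by
    intro N
    induction N with
    | zero => simp [X.toFun_zero]
    | succ N ih =>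
      simp only [Finset.sum_range_succ]
      exact (X.map_add_le _ _ (Finset.aemeasurable_fun_sum _ fun n _ => hu n) (hu N)).trans
        (by gcongr)
  rw [← X.fatou (fun N ω => ∑ n ∈ Finset.range N, u n ω) _
    (fun N => Finset.aemeasurable_fun_sum _ fun n _ => hu n) (AEMeasurable.tsum hu)
    (Eventually.of_forall fun ω => monotone_nat_of_le_succ fun N => by
      simp [Finset.sum_range_succ])
    (Eventually.of_forall fun ω => ENNReal.tsum_eq_iSup_nat.symm)]
  exact iSup_le fun N => (hfin N).trans (ENNReal.sum_le_tsum _)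

/-- Finite norm forces integrability on sets of finite measure, and these exhaust the space. -/
theorem ae_lt_top [SigmaFinite μ] {u : Ω → ℝ≥0∞} (hu : AEMeasurable u μ) (h : X.toFun u < ∞) :
    ∀ᵐ ω ∂μ, u ω < ∞ := by
  refine ae_of_forall_measure_lt_top_ae_restrict _ fun A hA hfin => ?_
  obtain ⟨C, hC⟩ := X.setLIntegral_le A hA hfin
  exact ae_lt_top' hu.restrict ((hC u hu).trans_lt (ENNReal.mul_lt_top ENNReal.coe_lt_top h)).ne

/-- The elements of the Banach function space, not identified up to a.e. equality. -/
def Elem : Type _ := {f : Ω → ℂ // f ∈ X.space}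

/-- Baire's theorem needs only a complete pseudometric, so no quotient by null functions is taken.
-/
noncomputable instance : PseudoEMetricSpace X.Elem where
  edist f g := X.norm (f.1 - g.1)
  edist_self f := by simp [norm_zero]
  edist_comm f g := X.norm_sub_comm _ _
  edist_triangle f g k := X.norm_sub_le_add f.2 g.2 k.2

theorem edist_def (f g : X.Elem) : edist f g = X.norm (f.1 - g.1) := rfl

/-- The Riesz–Fischer theorem. -/
instance [SigmaFinite μ] : CompleteSpace X.Elem := by
  refine EMetric.complete_of_convergent_controlled_sequences (fun n : ℕ => (2⁻¹ : ℝ≥0∞) ^ n)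
    (fun n => ENNReal.pow_pos (by simp) n) fun f hf => ?_
  have hstep : ∀ n, X.norm ((f (n + 1)).1 - (f n).1) ≤ 2⁻¹ ^ n := fun n =>
    (hf n (n + 1) n (Nat.le_succ n) le_rfl).le
  set u : ℕ → Ω → ℝ≥0∞ := fun n ω => ‖(f (n + 1)).1 ω - (f n).1 ω‖ₑ with hudef
  have hu : ∀ n, AEMeasurable (u n) μ := fun n => ((f (n + 1)).2.1.sub (f n).2.1).enorm
  have hun : ∀ n, X.toFun (u n) ≤ 2⁻¹ ^ n := hstep
  -- Countable subadditivity and a geometric series: the tail sums dominate `|f_N - g|` below, and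
  -- the case `N = 0` gives a.e. absolute convergence.
  have htail : ∀ N, X.toFun (fun ω => ∑' n, u (n + N) ω) ≤ 2⁻¹ ^ N * 2 := by
    intro N
    calc X.toFun (fun ω => ∑' n, u (n + N) ω) ≤ ∑' n, X.toFun (u (n + N)) :=
          X.toFun_tsum_le _ fun n => hu _
      _ ≤ ∑' n, 2⁻¹ ^ N * 2⁻¹ ^ n :=
          ENNReal.tsum_le_tsum fun n => (hun _).trans (by rw [pow_add, mul_comm])
      _ = 2⁻¹ ^ N * 2 := by
          rw [ENNReal.tsum_mul_left, ENNReal.tsum_geometric, ENNReal.one_sub_inv_two, inv_inv]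
  have hfin : ∀ᵐ ω ∂μ, ∑' n, u n ω < ∞ :=
    X.ae_lt_top (AEMeasurable.tsum hu)
      ((by simpa using htail 0 : _ ≤ (2 : ℝ≥0∞)).trans_lt (by simp))
  have hconv : ∀ᵐ ω ∂μ, ∃ l, Tendsto (fun n => (f n).1 ω) atTop (𝓝 l) := by
    filter_upwards [hfin] with ω hω
    refine cauchySeq_tendsto_of_complete (cauchySeq_of_edist_le_of_tsum_ne_top (fun n => u n ω)
      (fun n => ?_) hω.ne)
    rw [edist_comm, edist_eq_enorm_sub]
  obtain ⟨g, hg, hlim⟩ := exists_stronglyMeasurable_limit_of_tendsto_ae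
    (fun n => (f n).2.1) hconv
  have hdist : ∀ N, X.norm ((f N).1 - g) ≤ 2⁻¹ ^ N * 2 := by
    intro N
    refine (X.mono _ _ ((f N).2.1.sub hg.aestronglyMeasurable).enorm
      (AEMeasurable.tsum fun n => hu _) ?_).trans (htail N)
    filter_upwards [hlim] with ω hω
    rw [Pi.sub_apply, ← edist_eq_enorm_sub]
    simp only [add_comm _ N]
    refine edist_le_tsum_of_edist_le_of_tendsto (f := fun n => (f n).1 ω) (fun n => u n ω)
      (fun n => ?_) hω N
    rw [edist_comm, edist_eq_enorm_sub]
  have hmem : g ∈ X.space := by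
    have h1 : (f 0).1 - g ∈ X.space :=
      ⟨(f 0).2.1.sub hg.aestronglyMeasurable, (hdist 0).trans_lt (by simp)⟩
    simpa using sub_mem_space (f 0).2 h1
  obtain ⟨G, rfl⟩ : ∃ G : X.Elem, G.1 = g := ⟨⟨g, hmem⟩, rfl⟩
  refine ⟨G, tendsto_iff_edist_tendsto_0.2 ?_⟩
  refine tendsto_of_tendsto_of_tendsto_of_le_of_le tendsto_const_nhds ?_ (fun _ => zero_le)
    hdist
  have := ENNReal.Tendsto.mul_const (b := 2)
    (ENNReal.tendsto_pow_atTop_nhds_zero_of_lt_one (r := 2⁻¹) (by simp)) (Or.inr (by simp))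
  simpa using this

end RIFunctionNorm

/-! ### The Banach principle. -/

/-- A sequence of operators on a Banach function space that are linear up to null sets and bounded
into `L¹` of every set of finite measure. -/
structure IsLocallyBoundedSeq {Ω : Type*} [MeasurableSpace Ω] {μ : Measure Ω}
    (X : RIFunctionNorm μ) (S : ℕ → (Ω → ℂ) → (Ω → ℂ)) : Prop where
  measurable : ∀ n, ∀ f ∈ X.space, AEStronglyMeasurable (S n f) μ
  sub : ∀ n, ∀ f ∈ X.space, ∀ g ∈ X.space, S n (f - g) =ᵐ[μ] S n f - S n g
  smul : ∀ n (c : ℂ) f, S n (c • f) = c • S n f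
  bound : ∀ n A, MeasurableSet A → μ A < ∞ →
    ∃ C : ℝ≥0, ∀ f ∈ X.space, ∫⁻ ω in A, ‖S n f ω‖ₑ ∂μ ≤ C * X.norm f

namespace IsLocallyBoundedSeq

variable {Ω : Type*} [MeasurableSpace Ω] {μ : Measure Ω} {X : RIFunctionNorm μ}
  {S : ℕ → (Ω → ℂ) → (Ω → ℂ)}

theorem ae_exists_tendsto_sub (hS : IsLocallyBoundedSeq X S) {f g : Ω → ℂ} (hf : f ∈ X.space)
    (hg : g ∈ X.space) (hcf : ∀ᵐ ω ∂μ, ∃ l, Tendsto (fun n => S n f ω) atTop (𝓝 l))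
    (hcg : ∀ᵐ ω ∂μ, ∃ l, Tendsto (fun n => S n g ω) atTop (𝓝 l)) :
    ∀ᵐ ω ∂μ, ∃ l, Tendsto (fun n => S n (f - g) ω) atTop (𝓝 l) := by
  filter_upwards [hcf, hcg, ae_all_iff.2 fun n => hS.sub n f hf g hg] with ω ⟨l, hl⟩ ⟨l', hl'⟩ h
  exact ⟨l - l', by simpa only [h, Pi.sub_apply] using hl.sub hl'⟩

theorem ae_exists_tendsto_smul (hS : IsLocallyBoundedSeq X S) (c : ℂ) {f : Ω → ℂ}
    (hcf : ∀ᵐ ω ∂μ, ∃ l, Tendsto (fun n => S n f ω) atTop (𝓝 l)) :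
    ∀ᵐ ω ∂μ, ∃ l, Tendsto (fun n => S n (c • f) ω) atTop (𝓝 l) := by
  filter_upwards [hcf] with ω ⟨l, hl⟩
  exact ⟨c • l, by simpa only [hS.smul, Pi.smul_apply] using hl.const_smul c⟩

theorem ae_exists_tendsto_add (hS : IsLocallyBoundedSeq X S) {f g : Ω → ℂ} (hf : f ∈ X.space)
    (hg : g ∈ X.space) (hcf : ∀ᵐ ω ∂μ, ∃ l, Tendsto (fun n => S n f ω) atTop (𝓝 l))
    (hcg : ∀ᵐ ω ∂μ, ∃ l, Tendsto (fun n => S n g ω) atTop (𝓝 l)) :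
    ∀ᵐ ω ∂μ, ∃ l, Tendsto (fun n => S n (f + g) ω) atTop (𝓝 l) := by
  simpa using hS.ae_exists_tendsto_sub hf (RIFunctionNorm.smul_mem_space (-1) hg) hcf
    (hS.ae_exists_tendsto_smul (-1) hcg)

/-- Markov's inequality for finitely many operators. It plays the role of their continuity in
measure at `0` and lets maximal estimates pass to closures. -/
theorem exists_measure_partial_sup_le (hS : IsLocallyBoundedSeq X S) {A : Set Ω}
    (hA : MeasurableSet A) (hfin : μ A < ∞) (N : ℕ) {ε : ℝ≥0∞} (hε : 0 < ε) :
    ∃ r > 0, ∀ f ∈ X.space, X.norm f < r →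
      μ.restrict A {ω | ∃ n < N, 1 < ‖S n f ω‖ₑ} ≤ ε := by
  choose C hC using fun n => hS.bound n A hA hfin
  set D : ℝ≥0 := ∑ n ∈ Finset.range N, C n with hD
  have hbound : ∀ f ∈ X.space, μ.restrict A {ω | ∃ n < N, 1 < ‖S n f ω‖ₑ} ≤ D * X.norm f := by
    intro f hf
    have hset : {ω | ∃ n < N, 1 < ‖S n f ω‖ₑ} = ⋃ n ∈ Finset.range N, {ω | 1 < ‖S n f ω‖ₑ} := by
      ext ω; simp
    rw [hset, hD, ENNReal.ofNNReal_finsetSum, Finset.sum_mul]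
    refine (measure_biUnion_finset_le _ _).trans (Finset.sum_le_sum fun n _ => ?_)
    refine le_trans ?_ (hC n f hf)
    have := mul_meas_ge_le_lintegral₀ (hS.measurable n f hf).restrict.enorm (μ := μ.restrict A) 1
    rw [one_mul] at this
    refine le_trans (measure_mono ?_) this
    exact fun ω (hω : 1 < ‖S n f ω‖ₑ) => hω.le
  refine ⟨ε / (D + 1), ENNReal.div_pos hε.ne' (by simp), fun f hf hlt => (hbound f hf).trans ?_⟩
  calc (D : ℝ≥0∞) * X.norm f ≤ (D + 1) * (ε / (D + 1)) := by
        gcongr; exact le_self_add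
    _ ≤ ε := ENNReal.mul_div_le

theorem maximalOp_sub_le (hS : IsLocallyBoundedSeq X S) {f g : Ω → ℂ} (hf : f ∈ X.space)
    (hg : g ∈ X.space) :
    ∀ᵐ ω ∂μ, maximalOp S (f - g) ω ≤ maximalOp S f ω + maximalOp S g ω := by
  filter_upwards [ae_all_iff.2 fun n => hS.sub n f hf g hg] with ω hω
  refine iSup_le fun n => ?_
  rw [hω n]
  exact enorm_sub_le.trans (add_le_add (le_iSup (fun n => ‖S n f ω‖ₑ) n)
    (le_iSup (fun n => ‖S n g ω‖ₑ) n))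

variable [SigmaFinite μ]

/-- If the maximal function is finite a.e. on the whole space, then the maximal operator is
bounded in measure on some ball, on each set of finite measure. -/
theorem exists_measure_maximalOp_le (hS : IsLocallyBoundedSeq X S)
    (hmax : ∀ f ∈ X.space, ∀ᵐ ω ∂μ, maximalOp S f ω < ∞) {A : Set Ω} (hA : MeasurableSet A)
    (hfin : μ A < ∞) {ε : ℝ≥0∞} (hε : 0 < ε) :
    ∃ r > 0, ∃ m : ℝ≥0, ∀ f ∈ X.space, X.norm f < r →
      μ.restrict A {ω | m < maximalOp S f ω} ≤ ε := by
  have : IsFiniteMeasure (μ.restrict A) := ⟨by simpa using hfin⟩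
  have hε4 : 0 < ε / 4 := ENNReal.div_pos hε.ne' (by simp)
  -- These sets need not be closed, since Baire is applied to their closures. Passing to the closure
  -- turns `ε / 4` into `ε / 2`, and taking a difference of two elements turns that into `ε`.
  set F : ℕ → Set X.Elem := fun m =>
    {f | μ.restrict A {ω | (m : ℝ≥0∞) < maximalOp S f.1 ω} ≤ ε / 4} with hF
  have hmeas : ∀ (f : X.Elem) (m : ℝ≥0∞),
      NullMeasurableSet {ω | m < maximalOp S f.1 ω} (μ.restrict A) := fun f m =>
    nullMeasurableSet_lt aemeasurable_const
      (AEMeasurable.iSup fun n => (hS.measurable n f.1 f.2).restrict.enorm)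
  have hcover : ⋃ m, closure (F m) = Set.univ := by
    refine Set.eq_univ_of_forall fun f => Set.mem_iUnion.2 ?_
    have hlim : Tendsto (fun m : ℕ => μ.restrict A {ω | (m : ℝ≥0∞) < maximalOp S f.1 ω}) atTop
        (𝓝 (μ.restrict A (⋂ m : ℕ, {ω | (m : ℝ≥0∞) < maximalOp S f.1 ω}))) :=
      tendsto_measure_iInter_atTop (fun m => hmeas f m)
        (fun i j hij ω (hω : (j : ℝ≥0∞) < _) => lt_of_le_of_lt (by exact_mod_cast hij) hω)
        ⟨0, measure_ne_top _ _⟩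
    -- The intersection is where the maximal function is infinite. This is the use of a.e.
    -- finiteness.
    have hzero : μ.restrict A (⋂ m : ℕ, {ω | (m : ℝ≥0∞) < maximalOp S f.1 ω}) = 0 := by
      refine measure_mono_null ?_ (ae_restrict_of_ae (hmax f.1 f.2))
      intro ω hω
      simp only [Set.mem_iInter, Set.mem_ofPred_eq] at hω
      intro (hlt : maximalOp S f.1 ω < ∞)
      obtain ⟨n, hn⟩ := ENNReal.exists_nat_gt hlt.ne
      exact lt_asymm hn (hω n)
    rw [hzero] at hlim
    obtain ⟨m, hm⟩ := (hlim.eventually (gt_mem_nhds hε4)).exists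
    exact ⟨m, subset_closure hm.le⟩
  have : Nonempty X.Elem := ⟨⟨0, RIFunctionNorm.zero_mem_space⟩⟩
  obtain ⟨m, f₀, hf₀⟩ := nonempty_interior_of_iUnion_of_closed (fun m => isClosed_closure) hcover
  obtain ⟨r, hr, hball⟩ := EMetric.mem_nhds_iff.1 (mem_interior_iff_mem_nhds.1 hf₀)
  -- on the closure the estimate persists with worse constants
  have hclos : ∀ f ∈ closure (F m),
      μ.restrict A {ω | ((m + 1 : ℕ) : ℝ≥0∞) < maximalOp S f.1 ω} ≤ ε / 2 := by
    intro f hf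
    have hset : {ω | ((m + 1 : ℕ) : ℝ≥0∞) < maximalOp S f.1 ω} =
        ⋃ N : ℕ, {ω | ∃ n < N, ((m + 1 : ℕ) : ℝ≥0∞) < ‖S n f.1 ω‖ₑ} := by
      ext ω
      simp only [maximalOp, lt_iSup_iff, Set.mem_ofPred_eq, Set.mem_iUnion]
      exact ⟨fun ⟨n, hn⟩ => ⟨n + 1, n, n.lt_succ_self, hn⟩, fun ⟨_, n, _, hn⟩ => ⟨n, hn⟩⟩
    have hmono : Monotone fun N : ℕ =>
        {ω | ∃ n < N, ((m + 1 : ℕ) : ℝ≥0∞) < ‖S n f.1 ω‖ₑ} :=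
      fun i j hij ω ⟨n, hn, h⟩ => ⟨n, hn.trans_le hij, h⟩
    rw [hset, hmono.measure_iUnion]
    -- The approximant `g` may depend on `N`: only `N` operators have to be small on `f - g` at
    -- once.
    refine iSup_le fun N => ?_
    obtain ⟨r', hr', hN⟩ := hS.exists_measure_partial_sup_le hA hfin N hε4
    obtain ⟨g, hg, hfg⟩ := EMetric.mem_closure_iff.1 hf r' hr'
    have hsub : {ω | ∃ n < N, ((m + 1 : ℕ) : ℝ≥0∞) < ‖S n f.1 ω‖ₑ} ≤ᵐ[μ.restrict A]
        ({ω | (m : ℝ≥0∞) < maximalOp S g.1 ω} ∪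
          {ω | ∃ n < N, 1 < ‖S n (f.1 - g.1) ω‖ₑ} : Set Ω) := by
      filter_upwards [ae_restrict_of_ae (ae_all_iff.2 fun n => hS.sub n f.1 f.2 g.1 g.2)]
        with ω hω
      rintro ⟨n, hn, hlt⟩
      change _ ∨ _
      by_contra! hcon
      have h1 : maximalOp S g.1 ω ≤ m := not_lt.1 hcon.1
      have h2 : ¬ ∃ n < N, 1 < ‖S n (f.1 - g.1) ω‖ₑ := hcon.2
      have h3 : ‖S n (f.1 - g.1) ω‖ₑ ≤ 1 := not_lt.1 fun h => h2 ⟨n, hn, h⟩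
      refine hlt.not_ge ?_
      calc ‖S n f.1 ω‖ₑ = ‖S n g.1 ω + S n (f.1 - g.1) ω‖ₑ := by
            rw [hω n, Pi.sub_apply, add_sub_cancel]
        _ ≤ m + 1 := (enorm_add_le _ _).trans
            (add_le_add ((le_iSup (fun n => ‖S n g.1 ω‖ₑ) n).trans h1) h3)
        _ = ((m + 1 : ℕ) : ℝ≥0∞) := by push_cast; rfl
    calc μ.restrict A {ω | ∃ n < N, ((m + 1 : ℕ) : ℝ≥0∞) < ‖S n f.1 ω‖ₑ}
        ≤ _ := measure_mono_ae hsub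
      _ ≤ ε / 4 + ε / 4 := (measure_union_le _ _).trans
          (add_le_add hg (hN _ (RIFunctionNorm.sub_mem_space f.2 g.2) hfg))
      _ = ε / 2 := by
          rw [← two_mul, show (4 : ℝ≥0∞) = 2 * 2 by norm_num, ← mul_div_assoc,
            ENNReal.mul_div_mul_left _ _ (by simp) (by simp)]
  -- Recentre the ball: `f` is the difference of `f₀ + f` and `f₀`, both in the closure, whence
  -- twice the threshold `m + 1`.
  refine ⟨r, hr, 2 * (m + 1), fun f hf hfr => ?_⟩
  have hf₀' : f₀ ∈ closure (F m) := interior_subset hf₀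
  obtain ⟨f₁, hf₁⟩ : ∃ f₁ : X.Elem, f₁.1 = f₀.1 + f :=
    ⟨⟨f₀.1 + f, RIFunctionNorm.add_mem_space f₀.2 hf⟩, rfl⟩
  have hf₁' : f₁ ∈ closure (F m) := hball (by
    rw [Metric.mem_eball, RIFunctionNorm.edist_def, hf₁, add_sub_cancel_left]
    exact hfr)
  have hsub : {ω | ((2 * (m + 1) : ℝ≥0) : ℝ≥0∞) < maximalOp S f ω} ≤ᵐ[μ.restrict A]
      ({ω | ((m + 1 : ℕ) : ℝ≥0∞) < maximalOp S f₁.1 ω} ∪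
        {ω | ((m + 1 : ℕ) : ℝ≥0∞) < maximalOp S f₀.1 ω} : Set Ω) := by
    filter_upwards [ae_restrict_of_ae (hS.maximalOp_sub_le f₁.2 f₀.2)] with ω hω hlt
    rw [hf₁, add_sub_cancel_left, ← hf₁] at hω
    change _ ∨ _
    by_contra! hcon
    have h1 : maximalOp S f₁.1 ω ≤ ((m + 1 : ℕ) : ℝ≥0∞) := not_lt.1 hcon.1
    have h2 : maximalOp S f₀.1 ω ≤ ((m + 1 : ℕ) : ℝ≥0∞) := not_lt.1 hcon.2
    have h3 : ((2 * (m + 1) : ℝ≥0) : ℝ≥0∞) < maximalOp S f ω := hlt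
    refine h3.not_ge (hω.trans ((add_le_add h1 h2).trans (le_of_eq ?_)))
    push_cast; ring
  calc _ ≤ _ := measure_mono_ae hsub
    _ ≤ ε / 2 + ε / 2 := (measure_union_le _ _).trans
        (add_le_add (hclos _ hf₁') (hclos _ hf₀'))
    _ = ε := ENNReal.add_halves ε

/-- The Banach principle: a.e. convergence passes to limits in norm. -/
theorem ae_exists_tendsto (hS : IsLocallyBoundedSeq X S)
    (hmax : ∀ f ∈ X.space, ∀ᵐ ω ∂μ, maximalOp S f ω < ∞) {f : Ω → ℂ} (hf : f ∈ X.space)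
    (happrox : ∀ ε > 0, ∃ g ∈ X.space, X.norm (f - g) < ε ∧
      ∀ᵐ ω ∂μ, ∃ l, Tendsto (fun n => S n g ω) atTop (𝓝 l)) :
    ∀ᵐ ω ∂μ, ∃ l, Tendsto (fun n => S n f ω) atTop (𝓝 l) := by
  refine ae_of_forall_measure_lt_top_ae_restrict _ fun A hA hfin => ?_
  have hosc : ∀ k : ℕ, ∀ᵐ ω ∂μ.restrict A,
      ∃ N, ∀ n ≥ N, dist (S n f ω) (S N f ω) < 3 * (1 / (k + 1 : ℝ)) := by
    intro k
    set d : ℝ := 1 / (k + 1 : ℝ) with hd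
    have hd0 : 0 < d := Nat.one_div_pos_of_nat
    -- The set where the oscillation estimate fails is null because its measure is at most every `ε
    -- > 0`.
    refine le_antisymm (le_of_forall_pos_le_add fun ε hε => ?_) zero_le
    rw [zero_add]
    obtain ⟨r, hr, m, hm⟩ := hS.exists_measure_maximalOp_le hmax hA hfin hε
    -- rescale by a large integer
    set c : ℝ≥0 := (m + 1) / d.toNNReal with hc
    have hdn : 0 < d.toNNReal := Real.toNNReal_pos.2 hd0
    have hc0 : 0 < c := div_pos (by positivity) hdn
    obtain ⟨g, hg, hfg, hconv⟩ := happrox (r / c)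
      (ENNReal.div_pos hr.ne' ENNReal.coe_ne_top)
    have hsp := RIFunctionNorm.sub_mem_space hf hg
    have hce : ‖((c : ℝ) : ℂ)‖ₑ = c := by
      rw [enorm_eq_nnnorm]; simp
    have hle := hm (((c : ℝ) : ℂ) • (f - g)) (RIFunctionNorm.smul_mem_space _ hsp) (by
      rw [X.norm_smul _ hsp.1, hce, mul_comm]
      exact ENNReal.mul_lt_of_lt_div hfg)
    refine le_trans (measure_mono_ae ?_) hle
    filter_upwards [ae_restrict_of_ae hconv,
      ae_restrict_of_ae (ae_all_iff.2 fun n => hS.sub n f hf g hg)] with ω hω hsub hbad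
    by_contra hcon
    have h1 : maximalOp S (((c : ℝ) : ℂ) • (f - g)) ω ≤ m := not_lt.1 hcon
    refine hbad ?_
    obtain ⟨l, hl⟩ := hω
    obtain ⟨N, hN⟩ := Metric.cauchySeq_iff'.1 hl.cauchySeq d hd0
    refine ⟨N, fun n hn => ?_⟩
    -- Off the exceptional set `c |S_n (f - g)| ≤ m`, whereas `c d = m + 1`; so the gap is below `d`
    -- for all `n` at once.
    have hdiff : ∀ n, dist (S n f ω) (S n g ω) < d := by
      intro n
      have h2 := (le_iSup (fun n => ‖S n (((c : ℝ) : ℂ) • (f - g)) ω‖ₑ) n).trans h1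
      rw [hS.smul, Pi.smul_apply, hsub n, enorm_smul, hce, enorm_eq_nnnorm, ← ENNReal.coe_mul,
        ENNReal.coe_le_coe, Pi.sub_apply] at h2
      rw [dist_eq_norm]
      by_contra! h3
      have h4 : d.toNNReal ≤ ‖S n f ω - S n g ω‖₊ := Real.toNNReal_le_iff_le_coe.2 h3
      have h5 : m + 1 ≤ m := by
        calc m + 1 = c * d.toNNReal := by rw [hc, div_mul_cancel₀ _ hdn.ne']
          _ ≤ c * ‖S n f ω - S n g ω‖₊ := by gcongr
          _ ≤ m := h2
      exact absurd h5 (not_le.2 (lt_add_one m))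
    calc dist (S n f ω) (S N f ω)
        ≤ dist (S n f ω) (S n g ω) + dist (S n g ω) (S N g ω) + dist (S N g ω) (S N f ω) :=
          dist_triangle4 _ _ _ _
      _ < d + d + d := by
          have := hdiff N
          rw [dist_comm] at this
          exact add_lt_add (add_lt_add (hdiff n) (hN n hn)) this
      _ = 3 * d := by ring
  filter_upwards [ae_all_iff.2 hosc] with ω hω
  refine cauchySeq_tendsto_of_complete (Metric.cauchySeq_iff'.2 fun ε hε => ?_)
  obtain ⟨k, hk⟩ := exists_nat_one_div_lt (show 0 < ε / 3 by positivity)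
  obtain ⟨N, hN⟩ := hω k
  exact ⟨N, fun n hn => (hN n hn).trans (by linarith)⟩

end IsLocallyBoundedSeq

/-! ### Transferred operators: multiplicativity and local bounds. -/

section TransferredOperators

variable {Ω G : Type*} [MeasurableSpace Ω] {μ : Measure Ω}
  [AddCommGroup G] [AddAction G Ω]

theorem transfer_convOp_apply {Ω : Type*} [MeasurableSpace G] {h : Measure G} [AddAction G Ω]
    (k : G → ℂ) (f : Ω → ℂ) (ω : Ω) :
    transfer (convOp h k) f ω = ∫ s, k s * f ((0 - s) +ᵥ ω) ∂h := rfl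

/-- A measure preserving map leaves the distribution function unchanged. -/
theorem RIFunctionNorm.toFun_vadd [MeasurableConstVAdd G Ω] [VAddInvariantMeasure G Ω μ]
    (X : RIFunctionNorm μ) {f : Ω → ℂ} (hf : AEStronglyMeasurable f μ) (t : G) :
    X.toFun (fun ω => ‖f (t +ᵥ ω)‖ₑ) = X.norm f := by
  have hmp := measurePreserving_vadd t μ
  refine X.rearr _ _ (hf.comp_quasiMeasurePreserving hmp.quasiMeasurePreserving).enorm hf.enorm
    (Eventually.of_forall fun _ => enorm_lt_top) (Eventually.of_forall fun _ => enorm_lt_top)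
    fun s => ?_
  exact measure_preimage_vadd (μ := μ) t {ω | (s : ℝ≥0∞) < ‖f ω‖ₑ}

variable [MeasurableSpace G] {h : Measure G} [MeasurableVAdd₂ G Ω] [MeasurableNeg G]

theorem measurable_orbit_right (ω : Ω) :
    Measurable fun s : G => (0 - s) +ᵥ ω := by
  simp only [zero_sub]
  exact measurable_neg.vadd_const ω

variable (G) in
theorem measurable_orbit : Measurable fun p : Ω × G => (0 - p.2) +ᵥ p.1 := by
  simp only [zero_sub]
  exact measurable_snd.neg.vadd measurable_fst

/-- Transference is multiplicative on bounded functions. -/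
theorem transfer_transfer [MeasurableAdd₂ G] [SFinite h] [h.IsAddLeftInvariant] {k φ : G → ℂ}
    (hk : Integrable k h) (hφ : Integrable φ h) {g : Ω → ℂ} (hg : Measurable g)
    {M : ℝ} (hM : ∀ ω, ‖g ω‖ ≤ M) (ω : Ω) :
    transfer (convOp h k) (transfer (convOp h φ) g) ω =
      ∫ t, convOp h k φ t * g ((0 - t) +ᵥ ω) ∂h := by
  have horb : AEStronglyMeasurable (fun t : G => g ((0 - t) +ᵥ ω)) h :=
    (hg.comp (measurable_orbit_right ω)).aestronglyMeasurable
  have hconv : Integrable (fun p : G × G => k p.2 * φ (p.1 - p.2)) (h.prod h) :=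
    hk.convolution_integrand (ContinuousLinearMap.mul ℂ ℂ) hφ
  have hint : Integrable (fun p : G × G => k p.2 * φ (p.1 - p.2) * g ((0 - p.1) +ᵥ ω))
      (h.prod h) := by
    refine hconv.mul_bdd (c := M) horb.comp_fst (Eventually.of_forall fun p => hM _)
  -- Translating the inner variable by `s` makes the two orbit shifts compose to `-t`, independent
  -- of `s`; Fubini then leaves the convolution as the inner integral.
  calc transfer (convOp h k) (transfer (convOp h φ) g) ω
      = ∫ s, ∫ t, k s * φ (t - s) * g ((0 - t) +ᵥ ω) ∂h ∂h := by
        rw [transfer_convOp_apply]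
        congr 1
        ext s
        rw [transfer_convOp_apply, ← integral_sub_right_eq_self _ s, ← integral_const_mul]
        congr 1
        ext t
        rw [vadd_vadd, mul_assoc, zero_sub, zero_sub, zero_sub, neg_sub,
          sub_add_eq_add_sub, add_neg_cancel, zero_sub]
    _ = ∫ t, ∫ s, k s * φ (t - s) * g ((0 - t) +ᵥ ω) ∂h ∂h :=
        (integral_integral_swap hint).symm
    _ = _ := by
        congr 1
        ext t
        exact integral_mul_const _ _

/-- The orbit function of a bounded `g` is an admissible `L^∞` test function for the weak
convergence, at every `ω`. -/
theorem exists_tendsto_transfer_transfer [MeasurableAdd₂ G] [SFinite h] [h.IsAddLeftInvariant]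
    {k : ℕ → G → ℂ} {φ : G → ℂ} (hk : ∀ n, Integrable (k n) h) (hφ : Integrable φ h)
    (hweak : ConvergesWeaklyL1 h fun n => convOp h (k n) φ) {g : Ω → ℂ} (hg : Measurable g)
    {M : ℝ} (hM : ∀ ω, ‖g ω‖ ≤ M) (ω : Ω) :
    ∃ l, Tendsto (fun n => transfer (convOp h (k n)) (transfer (convOp h φ) g) ω) atTop (𝓝 l) := by
  obtain ⟨u, -, hu⟩ := hweak
  refine ⟨_, ((hu (fun t => g ((0 - t) +ᵥ ω)) ?_).congr fun n =>
    (transfer_transfer (hk n) hφ hg hM ω).symm)⟩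
  exact memLp_top_of_bound (hg.comp (measurable_orbit_right ω)).aestronglyMeasurable M
    (Eventually.of_forall fun t => hM _)

variable [VAddInvariantMeasure G Ω μ]

/-- Elements of the space are only a.e. measurable, so composing them with the orbit map requires
null sets to pull back to null sets. -/
theorem quasiMeasurePreserving_orbit [SFinite μ] [SFinite h] :
    Measure.QuasiMeasurePreserving (fun p : Ω × G => (0 - p.2) +ᵥ p.1) (μ.prod h) μ :=
  QuasiMeasurePreserving.prod_of_left (measurable_orbit G) (Eventually.of_forall fun s =>
    (measurePreserving_vadd (0 - s) μ).quasiMeasurePreserving)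

theorem aestronglyMeasurable_transfer [SFinite μ] [SFinite h] {k : G → ℂ}
    (hk : AEStronglyMeasurable k h) {f : Ω → ℂ} (hf : AEStronglyMeasurable f μ) :
    AEStronglyMeasurable (transfer (convOp h k) f) μ :=
  (hk.comp_snd.mul (hf.comp_quasiMeasurePreserving
    (quasiMeasurePreserving_orbit (h := h)))).integral_prod_right'

namespace RIFunctionNorm

variable (X : RIFunctionNorm μ)

/-- By Tonelli the integral over `A` goes inside, where translation invariance of the norm gives the
same bound for each `s`. The constant is `‖k‖₁` times that of the embedding into `L¹(A)`, and no
boundedness on `X` itself is needed. -/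
theorem exists_lintegral_orbit_le [SigmaFinite μ] [SFinite h] {k : G → ℂ} (hk : Integrable k h)
    {A : Set Ω} (hA : MeasurableSet A) (hfin : μ A < ∞) :
    ∃ C : ℝ≥0, ∀ f ∈ X.space,
      ∫⁻ ω in A, ∫⁻ s, ‖k s * f ((0 - s) +ᵥ ω)‖ₑ ∂h ∂μ ≤ C * X.norm f := by
  obtain ⟨C, hC⟩ := X.setLIntegral_le A hA hfin
  refine ⟨(∫⁻ s, ‖k s‖ₑ ∂h).toNNReal * C, fun f hf => ?_⟩
  have hmeas : AEStronglyMeasurable (fun p : Ω × G => k p.2 * f ((0 - p.2) +ᵥ p.1))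
      ((μ.restrict A).prod h) :=
    (hk.1.comp_snd.mul (hf.1.comp_quasiMeasurePreserving
      quasiMeasurePreserving_orbit)).mono_ac
      (Measure.AbsolutelyContinuous.prod Measure.restrict_le_self.absolutelyContinuous .rfl)
  rw [lintegral_lintegral_swap hmeas.enorm]
  calc ∫⁻ s, ∫⁻ ω in A, ‖k s * f ((0 - s) +ᵥ ω)‖ₑ ∂μ ∂h
      ≤ ∫⁻ s, ‖k s‖ₑ * (C * X.norm f) ∂h := by
        refine lintegral_mono fun s => ?_
        simp only [enorm_mul]
        rw [lintegral_const_mul' _ _ enorm_ne_top]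
        gcongr
        rw [← X.toFun_vadd hf.1 (0 - s)]
        exact hC _ (hf.1.comp_quasiMeasurePreserving
          (measurePreserving_vadd (0 - s) μ).quasiMeasurePreserving).enorm
    _ = _ := by
        rw [lintegral_mul_const'' _ hk.1.enorm, ENNReal.coe_mul,
          ENNReal.coe_toNNReal hk.2.ne, mul_assoc]

/-- The Bochner integral is additive only for integrable integrands, so differences are respected
off a null set, while scalars pass through everywhere. -/
theorem ae_integrable_orbit [SigmaFinite μ] [SFinite h] {k : G → ℂ} (hk : Integrable k h)
    {f : Ω → ℂ} (hf : f ∈ X.space) :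
    ∀ᵐ ω ∂μ, Integrable (fun s => k s * f ((0 - s) +ᵥ ω)) h := by
  have hmeas : AEStronglyMeasurable (fun p : Ω × G => k p.2 * f ((0 - p.2) +ᵥ p.1)) (μ.prod h) :=
    hk.1.comp_snd.mul (hf.1.comp_quasiMeasurePreserving quasiMeasurePreserving_orbit)
  have hlt : ∀ᵐ ω ∂μ, ∫⁻ s, ‖k s * f ((0 - s) +ᵥ ω)‖ₑ ∂h < ∞ := by
    refine ae_of_forall_measure_lt_top_ae_restrict _ fun A hA hfin => ?_
    obtain ⟨C, hC⟩ := X.exists_lintegral_orbit_le hk hA hfin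
    exact ae_lt_top' hmeas.enorm.lintegral_prod_right'.restrict
      ((hC f hf).trans_lt (ENNReal.mul_lt_top ENNReal.coe_lt_top hf.2)).ne
  filter_upwards [hlt, hmeas.prodMk_left] with ω h1 h2
  exact ⟨h2, h1⟩

theorem isLocallyBoundedSeq_transfer [SigmaFinite μ] [SFinite h] {k : ℕ → G → ℂ}
    (hk : ∀ n, Integrable (k n) h) :
    IsLocallyBoundedSeq X fun n => transfer (convOp h (k n)) where
  measurable n f hf := aestronglyMeasurable_transfer (hk n).1 hf.1
  sub n f hf g hg := by
    filter_upwards [X.ae_integrable_orbit (hk n) hf, X.ae_integrable_orbit (hk n) hg] with ω h1 h2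
    simp only [Pi.sub_apply, transfer_convOp_apply, mul_sub]
    exact integral_sub h1 h2
  smul n c f := by
    ext ω
    simp only [Pi.smul_apply, transfer_convOp_apply, smul_eq_mul, mul_left_comm _ c]
    exact integral_const_mul _ _
  bound n A hA hfin := by
    obtain ⟨C, hC⟩ := X.exists_lintegral_orbit_le (hk n) hA hfin
    exact ⟨C, fun f hf => (lintegral_mono fun ω => enorm_integral_le_lintegral_enorm _).trans
      (hC f hf)⟩

end RIFunctionNorm

end TransferredOperators

/-! ### Orlicz spaces under `Δ₂`. -/

section OrliczDelta2

variable {Ω : Type*} [MeasurableSpace Ω] {μ : Measure Ω} {Φ : ℝ≥0∞ → ℝ≥0∞}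

namespace SatisfiesDelta2

theorem exists_two_pow_le (hΔ : SatisfiesDelta2 Φ) (n : ℕ) :
    ∃ K : ℝ≥0, ∀ x : ℝ≥0∞, Φ (2 ^ n * x) ≤ K * Φ x := by
  obtain ⟨K, -, hK⟩ := hΔ
  refine ⟨K ^ n, fun x => ?_⟩
  induction n with
  | zero => simp
  | succ n ih =>
    rw [pow_succ', mul_assoc]
    refine (hK _).trans ?_
    rw [pow_succ', ENNReal.coe_mul, mul_assoc]
    gcongr

theorem exists_mul_le (hΔ : SatisfiesDelta2 Φ) (hΦ : IsYoungFunction Φ) (c : ℝ≥0) :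
    ∃ K : ℝ≥0, ∀ x : ℝ≥0∞, Φ (c * x) ≤ K * Φ x := by
  obtain ⟨n, hn⟩ := pow_unbounded_of_one_lt c one_lt_two
  obtain ⟨K, hK⟩ := hΔ.exists_two_pow_le n
  refine ⟨K, fun x => (hΦ.mono ?_).trans (hK x)⟩
  gcongr
  exact_mod_cast hn.le

/-- One positive point of finiteness spreads to all by dilation. -/
theorem lt_top (hΔ : SatisfiesDelta2 Φ) (hΦ : IsYoungFunction Φ) (x : ℝ≥0) : Φ x < ∞ := by
  obtain ⟨y, hy, hyt⟩ := hΦ.exists_lt_top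
  obtain ⟨K, hK⟩ := hΔ.exists_mul_le hΦ (x / y)
  have := hK y
  rw [← ENNReal.coe_mul, div_mul_cancel₀ _ hy.ne'] at this
  exact this.trans_lt (ENNReal.mul_lt_top ENNReal.coe_lt_top hyt)

/-- Finite norm makes the modular finite for one dilation; `Δ₂` extends this to every dilation, as
dominated convergence requires. -/
theorem lintegral_lt_top (hΔ : SatisfiesDelta2 Φ) (hΦ : IsYoungFunction Φ) {u : Ω → ℝ≥0∞}
    (hu : luxemburg μ Φ u < ∞) (c : ℝ≥0) : ∫⁻ ω, Φ (c * u ω) ∂μ < ∞ := by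
  obtain ⟨d, hd, hd1, -⟩ := exists_of_luxemburg_lt hu
  obtain ⟨K, hK⟩ := hΔ.exists_mul_le hΦ (c / d)
  calc ∫⁻ ω, Φ (c * u ω) ∂μ ≤ ∫⁻ ω, K * Φ (d * u ω) ∂μ := by
        refine lintegral_mono fun ω => ?_
        have := hK (d * u ω)
        rwa [← mul_assoc, ← ENNReal.coe_mul, div_mul_cancel₀ _ hd.ne'] at this
    _ = K * ∫⁻ ω, Φ (d * u ω) ∂μ := lintegral_const_mul' _ _ ENNReal.coe_ne_top
    _ < ∞ := ENNReal.mul_lt_top ENNReal.coe_lt_top (hd1.trans_lt ENNReal.one_lt_top)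

theorem tendsto_zero (hΔ : SatisfiesDelta2 Φ) (hΦ : IsYoungFunction Φ) :
    Tendsto Φ (𝓝 0) (𝓝 0) := by
  have h1 : ∀ᶠ x : ℝ≥0∞ in 𝓝 0, Φ x ≤ x * Φ 1 := by
    filter_upwards [gt_mem_nhds (zero_lt_one (α := ℝ≥0∞))] with x hx
    lift x to ℝ≥0 using (hx.trans ENNReal.one_lt_top).ne
    simpa using hΦ.scale_le x (by exact_mod_cast hx.le) 1
  have h2 : Tendsto (fun x : ℝ≥0∞ => x * Φ 1) (𝓝 0) (𝓝 0) := by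
    simpa using ENNReal.Tendsto.mul_const (b := Φ 1) (tendsto_id (x := 𝓝 (0 : ℝ≥0∞)))
      (Or.inr (by simpa using (hΔ.lt_top hΦ 1).ne))
  exact tendsto_of_tendsto_of_tendsto_of_le_of_le' tendsto_const_nhds h2
    (Eventually.of_forall fun _ => zero_le) h1

/-- Dominated convergence in Orlicz spaces. -/
theorem eventually_luxemburg_lt (hΔ : SatisfiesDelta2 Φ) (hΦ : IsYoungFunction Φ)
    {u : ℕ → Ω → ℝ≥0∞} {v : Ω → ℝ≥0∞} (hu : ∀ n, AEMeasurable (u n) μ)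
    (hv : luxemburg μ Φ v < ∞) (hle : ∀ n, u n ≤ᵐ[μ] v)
    (hlim : ∀ᵐ ω ∂μ, Tendsto (fun n => u n ω) atTop (𝓝 0)) {ε : ℝ≥0∞} (hε : 0 < ε) :
    ∀ᶠ n in atTop, luxemburg μ Φ (u n) < ε := by
  -- With `c > 1 / ε`, a modular at most `1` at dilation `c` forces the norm below `ε`.
  obtain ⟨c, hc⟩ := ENNReal.exists_nat_gt (ENNReal.inv_ne_top.2 hε.ne')
  have hc0 : 0 < (c : ℝ≥0) := by
    exact_mod_cast (pos_of_gt hc)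
  have hint : Tendsto (fun n => ∫⁻ ω, Φ ((c : ℝ≥0) * u n ω) ∂μ) atTop (𝓝 (∫⁻ _, 0 ∂μ)) := by
    refine tendsto_lintegral_of_dominated_convergence' (fun ω => Φ ((c : ℝ≥0) * v ω))
      (fun n => hΦ.comp (hu n) _) (fun n => ?_) (hΔ.lintegral_lt_top hΦ hv _).ne ?_
    · filter_upwards [hle n] with ω hω
      exact hΦ.mono (by gcongr)
    · filter_upwards [hlim] with ω hω
      refine (hΔ.tendsto_zero hΦ).comp ?_
      simpa using ENNReal.Tendsto.const_mul (a := ((c : ℝ≥0) : ℝ≥0∞)) hω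
        (Or.inr ENNReal.coe_ne_top)
  rw [lintegral_zero] at hint
  filter_upwards [hint.eventually (gt_mem_nhds zero_lt_one)] with n hn
  refine (luxemburg_le hc0 hn.le).trans_lt ?_
  rw [ENNReal.inv_lt_iff_inv_lt]
  exact_mod_cast hc

/-- Bounded functions that are small in `L¹` are small in `L(Φ)`. -/
theorem exists_luxemburg_lt (hΔ : SatisfiesDelta2 Φ) (hΦ : IsYoungFunction Φ) {ε : ℝ≥0∞}
    (hε : 0 < ε) : ∃ δ : ℝ≥0, 0 < δ ∧ ∀ u : Ω → ℝ≥0∞, (∀ ω, u ω ≤ 1) → ∫⁻ ω, u ω ∂μ ≤ δ →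
      luxemburg μ Φ u < ε := by
  obtain ⟨c, hc⟩ := ENNReal.exists_nat_gt (ENNReal.inv_ne_top.2 hε.ne')
  have hc0 : 0 < (c : ℝ≥0) := by
    exact_mod_cast (pos_of_gt hc)
  obtain ⟨b, hb⟩ : ∃ b : ℝ≥0, (b : ℝ≥0∞) = Φ (c : ℝ≥0) :=
    ⟨_, ENNReal.coe_toNNReal (hΔ.lt_top hΦ c).ne⟩
  -- Since `u ≤ 1`, convexity gives `Φ(c u) ≤ u Φ(c) = b u`, so the modular is at most `b / (b +
  -- 1)`.
  refine ⟨(b + 1)⁻¹, by positivity, fun u hu1 hu => (luxemburg_le hc0 ?_).trans_lt ?_⟩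
  · calc ∫⁻ ω, Φ ((c : ℝ≥0) * u ω) ∂μ ≤ ∫⁻ ω, b * u ω ∂μ := by
          refine lintegral_mono fun ω => ?_
          have hfin : u ω ≠ ∞ := ((hu1 ω).trans_lt ENNReal.one_lt_top).ne
          have := hΦ.scale_le (u ω).toNNReal
            (by rw [← ENNReal.coe_le_coe, ENNReal.coe_toNNReal hfin]; exact hu1 ω) (c : ℝ≥0)
          rwa [ENNReal.coe_toNNReal hfin, ← hb, mul_comm, mul_comm _ (b : ℝ≥0∞)] at this
      _ = b * ∫⁻ ω, u ω ∂μ := lintegral_const_mul' _ _ ENNReal.coe_ne_top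
      _ ≤ b * ((b + 1)⁻¹ : ℝ≥0) := by gcongr
      _ ≤ 1 := by
          rw [← ENNReal.coe_mul, ← ENNReal.coe_one, ENNReal.coe_le_coe, ← div_eq_mul_inv]
          exact div_le_one_of_le₀ (by simp) zero_le
  · rw [ENNReal.inv_lt_iff_inv_lt]
    exact_mod_cast hc

/-- Simple functions supported on sets of finite measure are dense in `L(Φ)`. -/
theorem exists_simpleFunc_norm_sub_lt [SigmaFinite μ] (hΔ : SatisfiesDelta2 Φ)
    (hΦ : IsYoungFunction Φ) {f : Ω → ℂ} (hf : f ∈ (orlicz μ Φ hΦ).space) {ε : ℝ≥0∞}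
    (hε : 0 < ε) : ∃ s : SimpleFunc Ω ℂ, μ (Function.support s) < ∞ ∧
      (orlicz μ Φ hΦ).norm (f - s) < ε := by
  set g := hf.1.mk f with hg
  have hgm : StronglyMeasurable g := hf.1.stronglyMeasurable_mk
  -- Approximating from the base point `0` keeps the error at most `|g|`, and cutting off to
  -- `spanningSets` gives finite support; both errors are thus dominated by `|f|`.
  set s : ℕ → SimpleFunc Ω ℂ := fun n =>
    (SimpleFunc.approxOn g hgm.measurable Set.univ 0 (Set.mem_univ _) n).restrict
      (spanningSets μ n) with hs
  have hsapp : ∀ n, (s n : Ω → ℂ) = (spanningSets μ n).indicator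
      (SimpleFunc.approxOn g hgm.measurable Set.univ 0 (Set.mem_univ _) n) := fun n =>
    SimpleFunc.coe_restrict _ (measurableSet_spanningSets μ n)
  have hev := hΔ.eventually_luxemburg_lt hΦ (μ := μ) (u := fun n ω => ‖(f - s n) ω‖ₑ)
    (v := fun ω => ‖f ω‖ₑ) (fun n => (hf.1.sub (s n).aestronglyMeasurable).enorm) hf.2 ?_ ?_ hε
  · obtain ⟨n, hn⟩ := hev.exists
    refine ⟨s n, (measure_mono ?_).trans_lt (measure_spanningSets_lt_top μ n), hn⟩
    rw [hsapp]
    exact Set.support_indicator_subset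
  · intro n
    filter_upwards [hf.1.ae_eq_mk] with ω hω
    rw [Pi.sub_apply, hsapp]
    by_cases hmem : ω ∈ spanningSets μ n
    · rw [Set.indicator_of_mem hmem, ← edist_eq_enorm_sub, edist_comm, hω]
      refine (SimpleFunc.edist_approxOn_le hgm.measurable (Set.mem_univ _) ω n).trans ?_
      exact (edist_zero_left (g ω)).le
    · rw [Set.indicator_of_notMem hmem, sub_zero]
  · filter_upwards [hf.1.ae_eq_mk] with ω hω
    have hlim := SimpleFunc.tendsto_approxOn hgm.measurable (Set.mem_univ (0 : ℂ))
      (x := ω) (by simp)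
    have h0 : Tendsto (fun n => f ω -
        SimpleFunc.approxOn g hgm.measurable Set.univ 0 (Set.mem_univ _) n ω) atTop (𝓝 0) := by
      have := hlim.const_sub (f ω)
      rwa [hω, sub_self, ← hω] at this
    have h1 := h0.enorm
    rw [enorm_zero] at h1
    refine h1.congr' ?_
    obtain ⟨N, hN⟩ := Set.mem_iUnion.1
      ((iUnion_spanningSets μ).symm ▸ Set.mem_univ ω : ω ∈ ⋃ N, spanningSets μ N)
    filter_upwards [eventually_ge_atTop N] with n hn
    rw [Pi.sub_apply, hsapp, Set.indicator_of_mem (monotone_spanningSets μ hn hN)]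

end SatisfiesDelta2

theorem indicator_mem_orlicz (hΦ : IsYoungFunction Φ) {A : Set Ω} (hA : MeasurableSet A)
    (hfin : μ A < ∞) : A.indicator (fun _ => (1 : ℂ)) ∈ (orlicz μ Φ hΦ).space := by
  refine ⟨(measurable_const.indicator hA).aestronglyMeasurable, ?_⟩
  have := hΦ.luxemburg_indicator_lt_top hA hfin
  refine lt_of_eq_of_lt ?_ this
  simp only [RIFunctionNorm.norm, enorm_indicator_eq_indicator_enorm, enorm_one]
  rfl

/-- A property of elements of an Orlicz space holds for simple functions supported on sets of
finite measure if it holds for indicators and is preserved under linear operations. -/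
theorem simpleFunc_orlicz_induction (hΦ : IsYoungFunction Φ) {P : (Ω → ℂ) → Prop}
    (hind : ∀ A, MeasurableSet A → μ A < ∞ → P (A.indicator fun _ => 1))
    (hsmul : ∀ (c : ℂ) f, P f → P (c • f))
    (hadd : ∀ f ∈ (orlicz μ Φ hΦ).space, ∀ g ∈ (orlicz μ Φ hΦ).space, P f → P g → P (f + g))
    (s : SimpleFunc Ω ℂ) (hs : μ (Function.support s) < ∞) :
    (s : Ω → ℂ) ∈ (orlicz μ Φ hΦ).space ∧ P s := by
  induction s using SimpleFunc.induction with
  | const c hA =>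
    rename_i A
    have heq : ((SimpleFunc.piecewise A hA (SimpleFunc.const Ω c) (SimpleFunc.const Ω 0) :
        SimpleFunc Ω ℂ) : Ω → ℂ) = c • A.indicator fun _ => (1 : ℂ) := by
      ext ω
      by_cases hω : ω ∈ A <;> simp [hω]
    rw [heq] at hs ⊢
    -- For `c = 0` the set `A` may have infinite measure, so the zero function is obtained from `∅`
    -- instead.
    rcases eq_or_ne c 0 with rfl | hc
    · have h0 := hsmul 0 _ (hind ∅ MeasurableSet.empty (by simp))
      rw [zero_smul] at h0 ⊢
      exact ⟨RIFunctionNorm.zero_mem_space, h0⟩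
    · have hfin : μ A < ∞ := by
        refine (measure_mono fun ω hω => ?_).trans_lt hs
        simp [hω, hc]
      exact ⟨RIFunctionNorm.smul_mem_space c (indicator_mem_orlicz hΦ hA hfin),
        hsmul c _ (hind A hA hfin)⟩
  | add hdisj hf hg =>
    rename_i f g
    -- Disjoint supports exclude cancellation, so each summand inherits a support of finite measure.
    have hsupp : Function.support (f + g : SimpleFunc Ω ℂ) =
        Function.support f ∪ Function.support g := by
      rw [SimpleFunc.coe_add]
      refine (Function.support_add _ _).antisymm ?_
      rintro ω (hω | hω)
      · have : g ω = 0 := Function.notMem_support.1 (Set.disjoint_left.1 hdisj hω)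
        simpa [this] using hω
      · have : f ω = 0 := Function.notMem_support.1 (Set.disjoint_right.1 hdisj hω)
        simpa [this] using hω
    rw [hsupp] at hs
    obtain ⟨hf1, hf2⟩ := hf ((measure_mono Set.subset_union_left).trans_lt hs)
    obtain ⟨hg1, hg2⟩ := hg ((measure_mono Set.subset_union_right).trans_lt hs)
    rw [SimpleFunc.coe_add]
    exact ⟨RIFunctionNorm.add_mem_space hf1 hg1, hadd _ hf1 _ hg1 hf2 hg2⟩

end OrliczDelta2

/-! ### Approximate identities along the action. -/

section Approximation

variable {Ω G : Type*} [MeasurableSpace Ω] {μ : Measure Ω} [AddCommGroup G] [AddAction G Ω]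

/-- For `a, b ∈ {0, 1}` one has `|a - b| = a + b - 2ab`. This expresses the `L¹` distance through
the one pairing that weak* continuity controls. -/
theorem lintegral_indicator_vadd_sub [MeasurableConstVAdd G Ω] [VAddInvariantMeasure G Ω μ]
    {A : Set Ω} (hA : MeasurableSet A) (hfin : μ A < ∞) (t : G) :
    ∫⁻ ω, ‖A.indicator (fun _ => (1 : ℂ)) (t +ᵥ ω) - A.indicator (fun _ => (1 : ℂ)) ω‖ₑ ∂μ =
      ENNReal.ofReal (2 * μ.real A - 2 * (∫ ω, A.indicator (fun _ => (1 : ℂ)) (t +ᵥ ω) *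
        A.indicator (fun _ => (1 : ℂ)) ω ∂μ).re) := by
  set g : Ω → ℂ := A.indicator fun _ => 1 with hg
  have hmp := measurePreserving_vadd t μ
  have hgi : Integrable g μ := (integrable_indicator_iff hA).2 (integrableOn_const hfin.ne)
  have hgt : Integrable (fun ω => g (t +ᵥ ω)) μ := hmp.integrable_comp_of_integrable hgi
  have hprod : Integrable (fun ω => g (t +ᵥ ω) * g ω) μ := by
    refine hgt.mul_bdd (c := 1) hgi.1 (Eventually.of_forall fun ω => ?_)
    by_cases hω : ω ∈ A <;> simp [hg, hω]
  have hgint : ∫ ω, g ω ∂μ = (μ.real A : ℂ) := by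
    rw [hg, integral_indicator_const _ hA]; simp
  have hgtint : ∫ ω, g (t +ᵥ ω) ∂μ = (μ.real A : ℂ) := by
    rw [← hgint]; exact integral_vadd_eq_self g
  have hnorm : ∀ ω, ((‖g (t +ᵥ ω) - g ω‖ : ℝ) : ℂ) =
      g (t +ᵥ ω) + g ω - 2 * (g (t +ᵥ ω) * g ω) := by
    intro ω
    by_cases h1 : ω ∈ A <;> by_cases h2 : t +ᵥ ω ∈ A <;> norm_num [hg, h1, h2]
  refine (ofReal_integral_norm_eq_lintegral_enorm (hgt.sub hgi)).symm.trans
    (congrArg ENNReal.ofReal ?_)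
  have hcast : ((∫ ω, ‖g (t +ᵥ ω) - g ω‖ ∂μ : ℝ) : ℂ) =
      2 * μ.real A - 2 * ∫ ω, g (t +ᵥ ω) * g ω ∂μ := by
    rw [← integral_complex_ofReal]
    simp only [hnorm]
    refine (integral_sub (hgt.add hgi) (hprod.const_mul 2)).trans ?_
    rw [integral_add' hgt hgi, integral_const_mul, hgint, hgtint, ← two_mul]
  have := congrArg Complex.re hcast
  simpa using this

/-- Weak* continuity of the action gives continuity in measure on sets of finite measure. -/
theorem IsPointWeakStarContinuous.tendsto_lintegral_indicator_sub [TopologicalSpace G]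
    [MeasurableConstVAdd G Ω] [VAddInvariantMeasure G Ω μ]
    (hcont : IsPointWeakStarContinuous G μ) {A : Set Ω} (hA : MeasurableSet A)
    (hfin : μ A < ∞) :
    Tendsto (fun t : G => ∫⁻ ω, ‖A.indicator (fun _ => (1 : ℂ)) (t +ᵥ ω) -
      A.indicator (fun _ => (1 : ℂ)) ω‖ₑ ∂μ) (𝓝 0) (𝓝 0) := by
  simp only [lintegral_indicator_vadd_sub hA hfin]
  have hgi : Integrable (A.indicator fun _ => (1 : ℂ)) μ :=
    (integrable_indicator_iff hA).2 (integrableOn_const hfin.ne)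
  have hc := hcont (A.indicator fun _ => 1) (memLp_indicator_const ∞ hA 1 (Or.inr hfin.ne)) _ hgi
  have hzero : (∫ ω, A.indicator (fun _ => (1 : ℂ)) ((0 : G) +ᵥ ω) *
      A.indicator (fun _ => (1 : ℂ)) ω ∂μ) = (μ.real A : ℂ) := by
    have : ∀ ω, A.indicator (fun _ => (1 : ℂ)) ((0 : G) +ᵥ ω) *
        A.indicator (fun _ => (1 : ℂ)) ω = A.indicator (fun _ => (1 : ℂ)) ω := by
      intro ω
      by_cases hω : ω ∈ A <;> simp [hω]
    simp only [this]
    rw [integral_indicator_const _ hA]; simp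
  have hlim := hc.tendsto 0
  rw [hzero] at hlim
  have hre := (Complex.continuous_re.tendsto _).comp hlim
  have := ENNReal.tendsto_ofReal ((hre.const_mul 2).const_sub (2 * μ.real A))
  simpa using this

variable [MeasurableSpace G] {h : Measure G} [MeasurableVAdd₂ G Ω] [MeasurableNeg G]
  [VAddInvariantMeasure G Ω μ]

/-- The value `g ω` is its own average over `U`, so the left side is the size of an average of
differences. -/
theorem enorm_transfer_indicator_sub_le {U : Set G} (hU : MeasurableSet U) (hU0 : h U ≠ 0)
    (hUt : h U ≠ ∞) {g : Ω → ℂ} (hg : Measurable g) {M : ℝ} (hM : ∀ ω, ‖g ω‖ ≤ M) (ω : Ω) :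
    ‖transfer (convOp h (U.indicator fun _ => ((h.real U)⁻¹ : ℂ))) g ω - g ω‖ₑ ≤
      (h U)⁻¹ * ∫⁻ s in U, ‖g ((0 - s) +ᵥ ω) - g ω‖ₑ ∂h := by
  have hreal : h.real U ≠ 0 := (ENNReal.toReal_ne_zero.2 ⟨hU0, hUt⟩)
  have hint : IntegrableOn (fun s : G => g ((0 - s) +ᵥ ω)) U h :=
    Measure.integrableOn_of_bounded (M := M) hUt
      (hg.comp (measurable_orbit_right ω)).aestronglyMeasurable (Eventually.of_forall fun _ => hM _)
  have heq : transfer (convOp h (U.indicator fun _ => ((h.real U)⁻¹ : ℂ))) g ω - g ω =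
      ((h.real U)⁻¹ : ℂ) * ∫ s in U, g ((0 - s) +ᵥ ω) - g ω ∂h := by
    rw [integral_sub hint (integrableOn_const hUt), setIntegral_const, mul_sub,
      Complex.real_smul, ← mul_assoc, inv_mul_cancel₀ (by exact_mod_cast hreal), one_mul,
      transfer_convOp_apply, ← integral_const_mul, ← integral_indicator hU]
    congr 2
    ext s
    by_cases hs : s ∈ U <;> simp [hs]
  rw [heq, enorm_mul, enorm_inv (by exact_mod_cast hreal)]
  have hn : ‖(h.real U : ℂ)‖ₑ = h U := by
    rw [← ofReal_norm, Complex.norm_real, Real.norm_of_nonneg measureReal_nonneg,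
      ofReal_measureReal hUt]
  rw [hn]
  gcongr
  exact enorm_integral_le_lintegral_enorm _

variable [TopologicalSpace G] [IsTopologicalAddGroup G] [LocallyCompactSpace G] [BorelSpace G]
  {Φ : ℝ≥0∞ → ℝ≥0∞}

theorem exists_transfer_indicator_norm_sub_lt [SFinite μ] [SFinite h] [h.IsAddHaarMeasure]
    (hcont : IsPointWeakStarContinuous G μ) (hΦ : IsYoungFunction Φ) (hΔ : SatisfiesDelta2 Φ)
    {A : Set Ω} (hA : MeasurableSet A) (hfin : μ A < ∞) {ε : ℝ≥0∞} (hε : 0 < ε) :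
    ∃ φ : G → ℂ, Integrable φ h ∧ h (Function.support φ) < ∞ ∧
      (orlicz μ Φ hΦ).norm (A.indicator (fun _ => 1) -
        transfer (convOp h φ) (A.indicator fun _ => 1)) < ε := by
  set g : Ω → ℂ := A.indicator fun _ => 1 with hg
  have hgm : Measurable g := measurable_const.indicator hA
  have hg1 : ∀ ω, ‖g ω‖ ≤ 1 := fun ω => by
    by_cases hω : ω ∈ A <;> simp [hg, hω]
  have hg2 : ∀ ω ω', ‖g ω - g ω'‖ₑ ≤ 1 := fun ω ω' => by
    by_cases hω : ω ∈ A <;> by_cases hω' : ω' ∈ A <;> simp [hg, hω, hω']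
  obtain ⟨δ, hδ, hsmall⟩ := hΔ.exists_luxemburg_lt hΦ (μ := μ) hε
  -- The transferred average runs over the shifts by `-s`, so smallness near `0` is pulled back
  -- along negation.
  have hneg : Tendsto (fun s : G => 0 - s) (𝓝 0) (𝓝 0) := by
    simpa using (tendsto_id (x := 𝓝 (0 : G))).neg
  have hev := ((hcont.tendsto_lintegral_indicator_sub hA hfin).comp hneg).eventually
    (gt_mem_nhds (show (0 : ℝ≥0∞) < δ by exact_mod_cast hδ))
  obtain ⟨K, hK, hK0⟩ := exists_compact_mem_nhds (0 : G)
  -- Openness makes the Haar measure of `U` positive, and inclusion in a compact set makes it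
  -- finite.
  obtain ⟨U, hUsub, hUo, hU0⟩ := mem_nhds_iff.1 (inter_mem hK0 hev)
  have hUm := hUo.measurableSet
  have hUpos : h U ≠ 0 := (hUo.measure_pos h ⟨0, hU0⟩).ne'
  have hUt : h U ≠ ∞ :=
    ((measure_mono fun s hs => (hUsub hs).1).trans_lt hK.measure_lt_top).ne
  refine ⟨U.indicator fun _ => ((h.real U)⁻¹ : ℂ),
    (integrable_indicator_iff hUm).2 (integrableOn_const hUt),
    (measure_mono Set.support_indicator_subset).trans_lt hUt.lt_top, ?_⟩
  have hbound := fun ω => enorm_transfer_indicator_sub_le (h := h) hUm hUpos hUt hgm hg1 ω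
  rw [RIFunctionNorm.norm_sub_comm]
  -- Averages of differences bounded by `1` stay below `1`; by Tonelli their `L¹` norm is an average
  -- of quantities below `δ`.
  refine hsmall _ (fun ω => (hbound ω).trans ?_) ((lintegral_mono hbound).trans ?_)
  · calc (h U)⁻¹ * ∫⁻ s in U, ‖g ((0 - s) +ᵥ ω) - g ω‖ₑ ∂h ≤ (h U)⁻¹ * ∫⁻ _ in U, 1 ∂h := by
          gcongr; exact hg2 _ _
      _ = 1 := by rw [setLIntegral_one, ENNReal.inv_mul_cancel hUpos hUt]
  · have hmeas : Measurable fun p : Ω × G => ‖g ((0 - p.2) +ᵥ p.1) - g p.1‖ₑ :=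
      ((hgm.comp (measurable_orbit G)).sub (hgm.comp measurable_fst)).enorm
    rw [lintegral_const_mul' _ _ (ENNReal.inv_ne_top.2 hUpos),
      lintegral_lintegral_swap hmeas.aemeasurable]
    calc (h U)⁻¹ * ∫⁻ s in U, ∫⁻ ω, ‖g ((0 - s) +ᵥ ω) - g ω‖ₑ ∂μ ∂h
        ≤ (h U)⁻¹ * ∫⁻ _ in U, δ ∂h := by
          gcongr 1
          exact setLIntegral_mono' hUm fun s hs => (hUsub hs).2.le
      _ = δ := by
          rw [setLIntegral_const, mul_comm (δ : ℝ≥0∞), ← mul_assoc,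
            ENNReal.inv_mul_cancel hUpos hUt, one_mul]

end Approximation

/-! ### Convergence on indicators, on `E`, and on `X`. -/

theorem mainTheorem7
    {Ω G : Type*} [MeasurableSpace Ω] (μ : Measure Ω) [SigmaFinite μ] (hμ : IsResonant μ)
    [AddCommGroup G] [TopologicalSpace G] [IsTopologicalAddGroup G] [LocallyCompactSpace G]
    [T2Space G] [SecondCountableTopology G] [MeasurableSpace G] [BorelSpace G]
    (h : Measure G) [h.IsAddHaarMeasure]
    [AddAction G Ω] [MeasurableVAdd₂ G Ω] [VAddInvariantMeasure G Ω μ]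
    (hcont : IsPointWeakStarContinuous G μ)
    (k : ℕ → G → ℂ) (hk_int : ∀ n, Integrable (k n) h) (hk_bdd : ∀ n, MemLp (k n) ∞ h)
    (hk_supp : ∀ n, ∃ K : Set G, IsCompact K ∧ ∀ᵐ t ∂h, t ∉ K → k n t = 0)
    (hk_mass : ∃ c : ℂ, Tendsto (fun n => ∫ t, k n t ∂h) atTop (𝓝 c))
    (hk_weak : ∀ φ : G → ℂ, Integrable φ h → h (Function.support φ) < ∞ →
      ConvergesWeaklyL1 h (fun n => convOp h (k n) φ))
    (X Y Z : RIFunctionNorm μ) (Φ : ℝ≥0∞ → ℝ≥0∞) (hΦ : IsYoungFunction Φ)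
    (hΔ : SatisfiesDelta2 Φ)
    (hXY : HasWeakType (maximalOp fun n => transfer (convOp h (k n))) X Y)
    (hEZ : HasWeakType (maximalOp fun n => transfer (convOp h (k n))) (orlicz μ Φ hΦ) Z)
    (hdense : ∀ f ∈ X.space, ∀ ε : ℝ≥0∞, 0 < ε →
      ∃ g ∈ X.space ∩ (orlicz μ Φ hΦ).space, X.norm (f - g) < ε) :
    ∀ f ∈ X.space, ∀ᵐ ω ∂μ, ∃ l : ℂ,
      Tendsto (fun n => transfer (convOp h (k n)) f ω) atTop (𝓝 l) := by
  have hX := X.isLocallyBoundedSeq_transfer hk_int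
  have hE := (orlicz μ Φ hΦ).isLocallyBoundedSeq_transfer hk_int
  have hXmax : ∀ f ∈ X.space, ∀ᵐ ω ∂μ,
      maximalOp (fun n => transfer (convOp h (k n))) f ω < ∞ := fun f hf => (hXY f hf).2.1
  have hEmax : ∀ f ∈ (orlicz μ Φ hΦ).space, ∀ᵐ ω ∂μ,
      maximalOp (fun n => transfer (convOp h (k n))) f ω < ∞ := fun f hf => (hEZ f hf).2.1
  have hind : ∀ A, MeasurableSet A → μ A < ∞ → ∀ᵐ ω ∂μ, ∃ l : ℂ,
      Tendsto (fun n => transfer (convOp h (k n)) (A.indicator fun _ => 1) ω) atTop (𝓝 l) := by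
    intro A hA hfin
    have hAE := indicator_mem_orlicz hΦ hA hfin
    refine hE.ae_exists_tendsto hEmax hAE fun ε hε => ?_
    -- The minimum with `1` makes the error finite in norm, which places `φ^# χ_A` in `E`.
    obtain ⟨φ, hφ, hsupp, hlt⟩ := exists_transfer_indicator_norm_sub_lt (h := h) hcont hΦ hΔ hA
      hfin (lt_min hε (zero_lt_one (α := ℝ≥0∞)))
    have hdiff : A.indicator (fun _ => (1 : ℂ)) -
        transfer (convOp h φ) (A.indicator fun _ => 1) ∈ (orlicz μ Φ hΦ).space :=
      ⟨hAE.1.sub (aestronglyMeasurable_transfer hφ.1 hAE.1),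
        hlt.trans ((min_le_right _ _).trans_lt ENNReal.one_lt_top)⟩
    refine ⟨transfer (convOp h φ) (A.indicator fun _ => 1), ?_, hlt.trans_le (min_le_left _ _),
      Eventually.of_forall fun ω => exists_tendsto_transfer_transfer hk_int hφ (hk_weak φ hφ hsupp)
        (measurable_const.indicator hA) (M := 1) (fun ω => ?_) ω⟩
    · simpa using RIFunctionNorm.sub_mem_space hAE hdiff
    · by_cases hω : ω ∈ A <;> simp [hω]
  have hEconv : ∀ f ∈ (orlicz μ Φ hΦ).space, ∀ᵐ ω ∂μ, ∃ l : ℂ,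
      Tendsto (fun n => transfer (convOp h (k n)) f ω) atTop (𝓝 l) := by
    intro f hf
    refine hE.ae_exists_tendsto hEmax hf fun ε hε => ?_
    obtain ⟨s, hs, hlt⟩ := hΔ.exists_simpleFunc_norm_sub_lt hΦ hf hε
    obtain ⟨hsE, hsconv⟩ := simpleFunc_orlicz_induction hΦ
      (P := fun f => ∀ᵐ ω ∂μ, ∃ l : ℂ,
        Tendsto (fun n => transfer (convOp h (k n)) f ω) atTop (𝓝 l)) hind
      (fun c f hf => hE.ae_exists_tendsto_smul c hf)
      (fun f hf g hg hcf hcg => hE.ae_exists_tendsto_add hf hg hcf hcg) s hs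
    exact ⟨s, hsE, hlt, hsconv⟩
  intro f hf
  refine hX.ae_exists_tendsto hXmax hf fun ε hε => ?_
  obtain ⟨g, ⟨hgX, hgE⟩, hlt⟩ := hdense f hf ε hε
  exact ⟨g, hgX, hlt, hEconv g hgE⟩
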